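/- Theorem (SETH-tight lower bound parameterized by $\mathrm{tw}(G^2)$). An instance $I$ of Neighborhood-Aware Graph Labeling (NAGL) with $L$ labels consists of a finite graph $G=(V,E)$ with $n=|V|\ge 1$ vertices and, for every vertex $v$, a local reward function $f_v:[L]^{N[v]}\to\mathbb{Q}$ on the labelings of its closed neighborhood $N[v]$, given succinctly by a Boolean circuit that evaluates it. To solve $I$ is to output a labeling $x\in[L]^V$ that maximizes $F(x)=\sum_{v\in V}f_v(x_{N[v]})$. Let $|I|\ge n$ denote the encoding size of $I$. The squared graph $G^2$ joins any two distinct vertices at distance at most two in $G$, and $\mathrm{tw}$ denotes treewidth. SETH is the assertion that for every $\delta>0$ there is an integer $k\ge 3$ such that $k$-SAT on $N$ variables (with no repeated clauses) cannot be solved in time $(2-\delta)^N\cdot N^{O(1)}$. Algorithms are deterministic unit-cost pointer machines (WHILE programs on binary trees), both for $k$-SAT and for NAGL. Fix an integer $L\ge 2$ and assume SETH. Then for every $\varepsilon>0$: 1. No algorithm solves NAGL with $L$ labels in time $(L-\varepsilon)^{\mathrm{tw}(G^2)}\cdot |I|^{O(1)}$; in particular, none does so in time $(L-\varepsilon)^{\mathrm{tw}(G^2)}\cdot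 n^{O(1)}$. 2. This holds even when $G$ is restricted to be a star and all local rewards take values in $\{0,1\}$. 3. There is a constant $c$ such that, even on the instances in which $G$ is a star, all local rewards take values in $\{0,1\}$, and $|I|\le c\,n^{c}$, no algorithm solves NAGL with $L$ labels in time $(L-\varepsilon)^{\mathrm{tw}(G^2)}\cdot n^{O(1)}$. -/

import Mathlib

/-! ## The machine model: WHILE programs over binary trees, with a step count

A program has finitely many registers, each of which holds a binary tree (a pointer to a cell, in
an implementation).  One step copies a pointer, allocates a cell, follows a pointer, or performs one
test.  This is the WHILE / pure LISP / pointer machine with its unit-cost time measure.  A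
random access machine executes each step in constant time, and conversely a program simulates a
random access machine running in time `T` with a factor `(log T) ^ O(1)`, so running times of the
form `c ^ N * N ^ O(1)` are the same in both models, for any fixed `c > 1`. -/

/-- Binary trees, the data on which programs operate. -/
inductive Dat : Type
  | nil : Dat
  | cons : Dat → Dat → Dat

namespace Dat

/-- The number of nodes of a tree. -/
def size : Dat → ℕ
  | nil => 1
  | cons a b => 1 + a.size + b.size

/-- First component (`nil` on `nil`). -/
def hd : Dat → Dat
  | nil => nil
  | cons a _ => a

/-- Second component (`nil` on `nil`). -/
def tl : Dat → Dat
  | nil => nil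
  | cons _ b => b

/-- A Boolean as a tree. -/
def ofBool : Bool → Dat
  | false => nil
  | true => cons nil nil

/-- A natural number in unary as a tree. -/
def ofNat : ℕ → Dat
  | 0 => nil
  | n + 1 => cons nil (ofNat n)

/-- A list of trees as a tree. -/
def ofList : List Dat → Dat
  | [] => nil
  | d :: l => cons d (ofList l)

end Dat

/-- WHILE programs; registers are named by natural numbers. -/
inductive Prog : Type
  /-- `x := nil` -/
  | setNil (x : ℕ) : Prog
  /-- `x := y` -/
  | copy (x y : ℕ) : Prog
  /-- `x := cons y z` -/
  | cons (x y z : ℕ) : Prog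
  /-- `x := hd y` -/
  | hd (x y : ℕ) : Prog
  /-- `x := tl y` -/
  | tl (x y : ℕ) : Prog
  /-- `p; q` -/
  | seq (p q : Prog) : Prog
  /-- `if x ≠ nil then p else q` -/
  | ite (x : ℕ) (p q : Prog) : Prog
  /-- `while x ≠ nil do p` -/
  | loop (x : ℕ) (p : Prog) : Prog

/-- The contents of all registers. -/
abbrev Store : Type := ℕ → Dat

/-- `Runs p s t s'`: started in the store `s`, the program `p` halts in the store `s'` after exactly
`t` steps. Every assignment and every test costs one step. -/
inductive Runs : Prog → Store → ℕ → Store → Prop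
  | setNil (x : ℕ) (s : Store) :
      Runs (.setNil x) s 1 (Function.update s x .nil)
  | copy (x y : ℕ) (s : Store) :
      Runs (.copy x y) s 1 (Function.update s x (s y))
  | cons (x y z : ℕ) (s : Store) :
      Runs (.cons x y z) s 1 (Function.update s x (.cons (s y) (s z)))
  | hd (x y : ℕ) (s : Store) :
      Runs (.hd x y) s 1 (Function.update s x (s y).hd)
  | tl (x y : ℕ) (s : Store) :
      Runs (.tl x y) s 1 (Function.update s x (s y).tl)
  | seq {p q : Prog} {s₁ s₂ s₃ : Store} {t u : ℕ} :
      Runs p s₁ t s₂ → Runs q s₂ u s₃ → Runs (.seq p q) s₁ (t + u) s₃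
  | iteTrue {x : ℕ} {p q : Prog} {s s' : Store} {t : ℕ} :
      s x ≠ .nil → Runs p s t s' → Runs (.ite x p q) s (1 + t) s'
  | iteFalse {x : ℕ} {p q : Prog} {s s' : Store} {t : ℕ} :
      s x = .nil → Runs q s t s' → Runs (.ite x p q) s (1 + t) s'
  | loopDone {x : ℕ} {p : Prog} {s : Store} :
      s x = .nil → Runs (.loop x p) s 1 s
  | loopStep {x : ℕ} {p : Prog} {s₁ s₂ s₃ : Store} {t u : ℕ} :
      s₁ x ≠ .nil → Runs p s₁ t s₂ → Runs (.loop x p) s₂ u s₃ →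
        Runs (.loop x p) s₁ (1 + t + u) s₃

/-- On input `d` (in register `0`, all other registers `nil`) the program `p` halts after exactly
`t` steps with output `e` in register `0`. -/
def Prog.Outputs (p : Prog) (d : Dat) (t : ℕ) (e : Dat) : Prop :=
  ∃ s' : Store, Runs p (fun i => if i = 0 then d else .nil) t s' ∧ s' 0 = e

/-! ## `k`-SAT and the Strong Exponential Time Hypothesis -/

/-- A CNF formula on `numVars` variables: a list of clauses without repetition, each clause being
a list of literals. The literal `(i, true)` is the variable `i`, and `(i, false)` its negation.
Since clauses are not repeated, a `k`-CNF formula has size polynomial in `numVars` for fixed `k`. -/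
structure CNF where
  numVars : ℕ
  clauses : List (List (Fin numVars × Bool))
  nodup : clauses.Nodup

namespace CNF

/-- Every clause has at most `k` literals. -/
def IsKCNF (φ : CNF) (k : ℕ) : Prop := ∀ c ∈ φ.clauses, c.length ≤ k

/-- Some assignment satisfies a literal in every clause. -/
def Satisfiable (φ : CNF) : Prop :=
  ∃ σ : Fin φ.numVars → Bool, ∀ c ∈ φ.clauses, ∃ l ∈ c, σ l.1 = l.2

/-- The formula as input of a program. -/
def encode (φ : CNF) : Dat :=
  .cons (.ofNat φ.numVars) (.ofList (φ.clauses.map fun c =>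
    .ofList (c.map fun l => .cons (.ofNat l.1) (.ofBool l.2))))

end CNF

open Classical in
/-- `k`-SAT on `N` variables is decided by a program in time `b ^ N * N ^ O(1)`
(with `N + 1` in place of `N`, so that formulas without variables get a constant time). -/
def KSATSolvable (k : ℕ) (b : ℝ) : Prop :=
  ∃ (p : Prog) (C : ℕ), ∀ φ : CNF, φ.IsKCNF k →
    ∃ t : ℕ, p.Outputs φ.encode t (.ofBool (decide φ.Satisfiable)) ∧
      (t : ℝ) ≤ C * b ^ φ.numVars * ((φ.numVars : ℝ) + 1) ^ C

/-- The Strong Exponential Time Hypothesis. -/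
def SETH : Prop :=
  ∀ δ : ℝ, 0 < δ → ∃ k : ℕ, 3 ≤ k ∧ ¬ KSATSolvable k (2 - δ)

/-! ## Squared graphs and treewidth -/

/-- The squared graph: distinct vertices at distance at most two are adjacent. -/
def squaredGraph {V : Type} (G : SimpleGraph V) : SimpleGraph V where
  Adj u v := u ≠ v ∧ G.edist u v ≤ 2
  symm := ⟨fun u v h => ⟨h.1.symm, by rw [SimpleGraph.edist_comm]; exact h.2⟩⟩
  loopless := ⟨fun _ h => h.1 rfl⟩

/-- Tree decompositions of `G`. -/
structure TreeDecomposition {V : Type} (G : SimpleGraph V) where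
  I : Type
  [fintypeI : Fintype I]
  tree : SimpleGraph I
  isTree : tree.IsTree
  bag : I → Finset V
  vertex_mem : ∀ v : V, ∃ i, v ∈ bag i
  edge_mem : ∀ u v : V, G.Adj u v → ∃ i, u ∈ bag i ∧ v ∈ bag i
  connected : ∀ v : V, (tree.induce {i | v ∈ bag i}).Connected

/-- The largest size of a bag, minus one. -/
def TreeDecomposition.width {V : Type} {G : SimpleGraph V} (D : TreeDecomposition G) : ℕ :=
  letI := D.fintypeI
  (Finset.univ.sup fun i => (D.bag i).card) - 1

/-- The minimum width over all tree decompositions (of a nonempty finite graph). -/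
noncomputable def treewidth {V : Type} (G : SimpleGraph V) : ℕ :=
  sInf {w | ∃ D : TreeDecomposition G, D.width = w}

/-! ## Boolean circuits: the succinct representation of the local rewards -/

/-- Gates of a circuit whose input is an assignment `a : ι → Fin L`. The gate `input u ℓ` tests
whether `a u = ℓ`. The argument `i` of a logical gate refers to the gate `i + 1` places earlier. -/
inductive Gate (ι : Type) (L : ℕ) : Type
  | const (b : Bool) : Gate ι L
  | input (u : ι) (ℓ : Fin L) : Gate ι L
  | not (i : ℕ) : Gate ι L
  | and (i j : ℕ) : Gate ι L
  | or (i j : ℕ) : Gate ι L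

/-- The value of a gate, where `w` lists the values of the earlier gates, the latest first
(a reference to a gate that does not exist counts as `false`). -/
def Gate.eval {ι : Type} {L : ℕ} (a : ι → Fin L) (w : List Bool) : Gate ι L → Bool
  | .const b => b
  | .input u ℓ => decide (a u = ℓ)
  | .not i => !(w.getD i false)
  | .and i j => w.getD i false && w.getD j false
  | .or i j => w.getD i false || w.getD j false

/-- The gate as part of the input of a program, given names `name u` of the vertices. -/
def Gate.encode {ι : Type} {L : ℕ} (name : ι → ℕ) : Gate ι L → Dat
  | .const b => .cons (.ofNat 0) (.ofBool b)
  | .input u ℓ => .cons (.ofNat 1) (.cons (.ofNat (name u)) (.ofNat ℓ))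
  | .not i => .cons (.ofNat 2) (.ofNat i)
  | .and i j => .cons (.ofNat 3) (.cons (.ofNat i) (.ofNat j))
  | .or i j => .cons (.ofNat 4) (.cons (.ofNat i) (.ofNat j))

/-- The number with binary digits `l`, least significant digit first. -/
def natOfBits : List Bool → ℕ
  | [] => 0
  | b :: l => b.toNat + 2 * natOfBits l

/-- A circuit that computes a rational number: a list of gates in order of evaluation, an output
gate for the sign, and output gates for the binary digits of the numerator and of the
denominator minus one. Output gates are counted backwards, `0` being the last gate. -/
structure Circuit (ι : Type) (L : ℕ) where
  gates : List (Gate ι L)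
  sign : ℕ
  num : List ℕ
  den : List ℕ

namespace Circuit

variable {ι : Type} {L : ℕ}

/-- The values of all gates, the last gate first. -/
def wires (c : Circuit ι L) (a : ι → Fin L) : List Bool :=
  c.gates.foldl (fun w g => g.eval a w :: w) []

/-- The number computed by the circuit. -/
def value (c : Circuit ι L) (a : ι → Fin L) : ℚ :=
  let bit : ℕ → Bool := fun i => (c.wires a).getD i false
  (if bit c.sign then -1 else 1) * (natOfBits (c.num.map bit) : ℚ) /
    ((natOfBits (c.den.map bit) : ℚ) + 1)

/-- The circuit as part of the input of a program. -/
def encode (name : ι → ℕ) (c : Circuit ι L) : Dat :=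
  .cons (.ofList (c.gates.map (Gate.encode name)))
    (.cons (.ofNat c.sign)
      (.cons (.ofList (c.num.map Dat.ofNat)) (.ofList (c.den.map Dat.ofNat))))

end Circuit

/-! ## Neighborhood-Aware Graph Labeling -/

/-- The closed neighborhood of a vertex. -/
def closedNbhd {V : Type} (G : SimpleGraph V) (v : V) : Set V := {u | u = v ∨ G.Adj v u}

/-- An instance of NAGL with label set `Fin L`: a graph on `n ≥ 1` vertices, and for each vertex `v`
a circuit that computes the reward of `v` from the labels of its closed neighborhood. -/
structure NAGLInstance (L : ℕ) where
  n : ℕ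
  n_pos : 0 < n
  graph : SimpleGraph (Fin n)
  reward : (v : Fin n) → Circuit (closedNbhd graph v) L

namespace NAGLInstance

variable {L : ℕ}

/-- The reward of the vertex `v` as a function of the labels of its closed neighborhood. -/
def localReward (I : NAGLInstance L) (v : Fin I.n) (a : closedNbhd I.graph v → Fin L) : ℚ :=
  (I.reward v).value a

/-- The total reward of a labeling. -/
def totalReward (I : NAGLInstance L) (x : Fin I.n → Fin L) : ℚ :=
  ∑ v, I.localReward v (fun u => x u)

/-- The labeling `x` maximizes the total reward. -/
def IsOptimal (I : NAGLInstance L) (x : Fin I.n → Fin L) : Prop :=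
  ∀ y, I.totalReward y ≤ I.totalReward x

/-- The graph is a star. -/
def IsStar (I : NAGLInstance L) : Prop :=
  ∃ c, I.graph = SimpleGraph.starGraph c

/-- All local rewards take values in `{0, 1}`. -/
def HasZeroOneRewards (I : NAGLInstance L) : Prop :=
  ∀ v a, I.localReward v a = 0 ∨ I.localReward v a = 1

open Classical in
/-- The instance as input of a program: for each vertex, its row of the adjacency matrix and the
circuit of its reward. -/
noncomputable def encode (I : NAGLInstance L) : Dat :=
  .ofList (List.ofFn fun v : Fin I.n =>
    .cons (.ofList (List.ofFn fun u : Fin I.n => .ofBool (decide (I.graph.Adj v u))))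
      ((I.reward v).encode fun u => u.1.1))

/-- The encoding size of the instance (at least the number `n` of vertices). -/
noncomputable def size (I : NAGLInstance L) : ℕ := I.encode.size

/-- The treewidth of the squared graph. -/
noncomputable def twSq (I : NAGLInstance L) : ℕ := treewidth (squaredGraph I.graph)

/-- A labeling as output of a program. -/
def encodeLabeling {n : ℕ} (x : Fin n → Fin L) : Dat :=
  .ofList (List.ofFn fun v => .ofNat (x v))

end NAGLInstance

/-- Some program solves NAGL on all instances with the property `P`, that is, outputs an optimal
labeling, within the time bound `T`. -/
def NAGLSolvable {L : ℕ} (P : NAGLInstance L → Prop) (T : NAGLInstance L → ℝ) : Prop :=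
  ∃ p : Prog, ∀ I : NAGLInstance L, P I →
    ∃ (t : ℕ) (x : Fin I.n → Fin L), I.IsOptimal x ∧
      p.Outputs I.encode t (NAGLInstance.encodeLabeling x) ∧ (t : ℝ) ≤ T I

/-! The reduction is from `k`-SAT. Cut the `N` variables into blocks of `q` consecutive ones and
store each block in `p` labels through an injection `enc` from bit strings of length `q` to
`p`-tuples of labels, which exists as soon as `2 ^ q ≤ L ^ p`. Take a star whose leaves carry these
labels. Its center sees everything, and its circuit pays 1 exactly when the labels, decoded block by
block, make a literal true in every clause; leaves pay 0. Hence an optimal labeling has value 1 iff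
the formula is satisfiable (`cnfHolds_iff_satisfiable`).

A single bag shows that `tw(G²)` is at most the number of leaves, `p * (N / q + 1)`. Time `b ^
tw(G²) * |I| ^ O(1)` therefore gives `k`-SAT in time `(b ^ (p / q)) ^ N * N ^ O(1)` for `b ≥ 1`
(`kSATSolvable_of_nAGLSolvable`). For `b < L` the ratio can be chosen with `b ^ p < 2 ^ q ≤ L ^ p`
(`exists_pow_lt_two_pow_le`), so that the new base is below 2, against SETH. A `k`-CNF formula
without repeated clauses has size polynomial in `N`, so the instances have size polynomial in `n`,
which gives the version with `n` in place of `|I|`.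

Since time is counted on a concrete machine, the reduction and the final check of the labeling have
to be programs. They are obtained from closure properties of the predicate `PC` (composition,
pairing, case distinction, folds over lists). The numbers `L`, `p`, `q` and the map `enc` are fixed,
so whatever depends on `enc` is a finite table hard-wired into the program (`PC.cnfInstance`,
`PC.cnfCheck`). -/

/-! ## Calling programs as subroutines -/

namespace Prog

/-- All registers of the program are below `p.bound`. -/
def bound : Prog → ℕ
  | setNil x => x + 1
  | copy x y => x + y + 1
  | cons x y z => x + y + z + 1
  | hd x y => x + y + 1
  | tl x y => x + y + 1
  | seq p q => p.bound + q.bound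
  | ite x p q => x + 1 + p.bound + q.bound
  | loop x p => x + 1 + p.bound

/-- The program with all registers shifted by `k`. -/
def shift (k : ℕ) : Prog → Prog
  | setNil x => setNil (k + x)
  | copy x y => copy (k + x) (k + y)
  | cons x y z => cons (k + x) (k + y) (k + z)
  | hd x y => hd (k + x) (k + y)
  | tl x y => tl (k + x) (k + y)
  | seq p q => seq (p.shift k) (q.shift k)
  | ite x p q => ite (k + x) (p.shift k) (q.shift k)
  | loop x p => loop (k + x) (p.shift k)

/-- Clear the registers from `k` up to `k + m`. -/
def clear (k : ℕ) : ℕ → Prog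
  | 0 => setNil k
  | m + 1 => seq (clear k m) (setNil (k + m + 1))

/-- Run `p` on the contents of register `x`, in the registers from `k` on, and store its output in
register `y`. -/
def call (p : Prog) (x y k : ℕ) : Prog :=
  seq (clear (k + 1) p.bound) (seq (copy k x) (seq (p.shift k) (copy y k)))

/-- `p` transforms the first `k` registers of `S` into those of `R` in `t` steps. -/
def Trans (k : ℕ) (p : Prog) (S : Store) (t : ℕ) (R : Store) : Prop :=
  ∀ S₀ : Store, (∀ r < k, S₀ r = S r) → ∃ S' : Store, Runs p S₀ t S' ∧ ∀ r < k, S' r = R r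

end Prog

theorem Runs.one_le {p : Prog} {s s' : Store} {t : ℕ} (h : Runs p s t s') : 1 ≤ t := by
  induction h <;> omega

/-- Both runs take the same steps on a window of `M` registers. The window is only required to
contain the registers of `p`, so that it stays the same when the induction passes to subprograms
with a smaller bound. -/
theorem Runs.shift {p : Prog} {s s' : Store} {t : ℕ} (h : Runs p s t s') (k M : ℕ)
    (hM : p.bound ≤ M) (S : Store) (hS : ∀ r < M, S (k + r) = s r) :
    ∃ S' : Store, Runs (p.shift k) S t S' ∧ (∀ r < M, S' (k + r) = s' r) ∧
      ∀ r < k, S' r = S r := by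
  have upd : ∀ (S s : Store) (x : ℕ) (d : Dat), (∀ r < M, S (k + r) = s r) →
      (∀ r < M, Function.update S (k + x) d (k + r) = Function.update s x d r) ∧
        ∀ r < k, Function.update S (k + x) d r = S r := by
    intro S s x d hS
    refine ⟨fun r hr => ?_, fun r hr => Function.update_of_ne (by omega) _ _⟩
    by_cases hx : r = x
    · subst hx; simp
    · rw [Function.update_of_ne (by omega), Function.update_of_ne hx, hS r hr]
  induction h generalizing S with
  | setNil x s => exact ⟨_, .setNil _ _, upd _ _ _ _ hS⟩
  | copy x y s =>
    simp only [Prog.bound] at hM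
    refine ⟨_, .copy _ _ _, ?_⟩
    rw [hS y (by omega)]; exact upd _ _ _ _ hS
  | cons x y z s =>
    simp only [Prog.bound] at hM
    refine ⟨_, .cons _ _ _ _, ?_⟩
    rw [hS y (by omega), hS z (by omega)]; exact upd _ _ _ _ hS
  | hd x y s =>
    simp only [Prog.bound] at hM
    refine ⟨_, .hd _ _ _, ?_⟩
    rw [hS y (by omega)]; exact upd _ _ _ _ hS
  | tl x y s =>
    simp only [Prog.bound] at hM
    refine ⟨_, .tl _ _ _, ?_⟩
    rw [hS y (by omega)]; exact upd _ _ _ _ hS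
  | seq _ _ ih₁ ih₂ =>
    simp only [Prog.bound] at hM
    obtain ⟨S₁, h₁, a₁, b₁⟩ := ih₁ (by omega) S hS
    obtain ⟨S₂, h₂, a₂, b₂⟩ := ih₂ (by omega) S₁ a₁
    exact ⟨S₂, .seq h₁ h₂, a₂, fun r hr => (b₂ r hr).trans (b₁ r hr)⟩
  | iteTrue hx _ ih =>
    simp only [Prog.bound] at hM
    obtain ⟨S₁, h₁, a₁, b₁⟩ := ih (by omega) S hS
    exact ⟨S₁, .iteTrue (by rwa [hS _ (by omega)]) h₁, a₁, b₁⟩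
  | iteFalse hx _ ih =>
    simp only [Prog.bound] at hM
    obtain ⟨S₁, h₁, a₁, b₁⟩ := ih (by omega) S hS
    exact ⟨S₁, .iteFalse (by rwa [hS _ (by omega)]) h₁, a₁, b₁⟩
  | loopDone hx =>
    simp only [Prog.bound] at hM
    exact ⟨S, .loopDone (by rwa [hS _ (by omega)]), hS, fun _ _ => rfl⟩
  | loopStep hx _ _ ih₁ ih₂ =>
    have hM' := hM
    simp only [Prog.bound] at hM'
    obtain ⟨S₁, h₁, a₁, b₁⟩ := ih₁ (by omega) S hS
    obtain ⟨S₂, h₂, a₂, b₂⟩ := ih₂ hM S₁ a₁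
    exact ⟨S₂, .loopStep (by rwa [hS _ (by omega)]) h₁ h₂, a₂,
      fun r hr => (b₂ r hr).trans (b₁ r hr)⟩

namespace Prog

theorem runs_clear (k m : ℕ) (S : Store) :
    ∃ S' : Store, Runs (clear k m) S (m + 1) S' ∧ (∀ r, k ≤ r → r ≤ k + m → S' r = .nil) ∧
      ∀ r < k, S' r = S r := by
  induction m with
  | zero =>
    refine ⟨_, .setNil _ _, fun r h₁ h₂ => ?_, fun r hr => Function.update_of_ne (by omega) _ _⟩
    obtain rfl : r = k := by omega
    simp
  | succ m ih =>
    obtain ⟨S₁, h₁, a₁, b₁⟩ := ih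
    refine ⟨_, .seq h₁ (.setNil _ _), fun r h₁ h₂ => ?_, fun r hr => ?_⟩
    · by_cases h : r = k + m + 1
      · subst h; simp
      · rw [Function.update_of_ne h, a₁ r h₁ (by omega)]
    · rw [Function.update_of_ne (by omega), b₁ r hr]

namespace Trans

variable {k : ℕ} {p q : Prog} {S R Q : Store} {t u : ℕ}

theorem seq (hp : Trans k p S t R) (hq : Trans k q R u Q) : Trans k (.seq p q) S (t + u) Q := by
  intro S₀ h₀
  obtain ⟨S₁, h₁, a₁⟩ := hp S₀ h₀
  obtain ⟨S₂, h₂, a₂⟩ := hq S₁ a₁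
  exact ⟨S₂, .seq h₁ h₂, a₂⟩

theorem update_congr {S₀ S : Store} (h : ∀ r < k, S₀ r = S r) (x : ℕ) (d : Dat) :
    ∀ r < k, Function.update S₀ x d r = Function.update S x d r := by
  intro r hr
  by_cases hx : r = x
  · subst hx; simp
  · rw [Function.update_of_ne hx, Function.update_of_ne hx, h r hr]

theorem copy (x : ℕ) {y : ℕ} (hy : y < k) (S : Store) :
    Trans k (.copy x y) S 1 (Function.update S x (S y)) := fun S₀ h =>
  ⟨_, .copy _ _ _, by rw [h y hy]; exact update_congr h _ _⟩

theorem cons (x : ℕ) {y z : ℕ} (hy : y < k) (hz : z < k) (S : Store) :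
    Trans k (.cons x y z) S 1 (Function.update S x (.cons (S y) (S z))) := fun S₀ h =>
  ⟨_, .cons _ _ _ _, by rw [h y hy, h z hz]; exact update_congr h _ _⟩

theorem hd (x : ℕ) {y : ℕ} (hy : y < k) (S : Store) :
    Trans k (.hd x y) S 1 (Function.update S x (S y).hd) := fun S₀ h =>
  ⟨_, .hd _ _ _, by rw [h y hy]; exact update_congr h _ _⟩

theorem tl (x : ℕ) {y : ℕ} (hy : y < k) (S : Store) :
    Trans k (.tl x y) S 1 (Function.update S x (S y).tl) := fun S₀ h =>
  ⟨_, .tl _ _ _, by rw [h y hy]; exact update_congr h _ _⟩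

theorem iteTrue {x : ℕ} (hx : x < k) (h : S x ≠ .nil) (hp : Trans k p S t R) :
    Trans k (.ite x p q) S (1 + t) R := by
  intro S₀ h₀
  obtain ⟨S₁, h₁, a₁⟩ := hp S₀ h₀
  exact ⟨S₁, .iteTrue (by rwa [h₀ x hx]) h₁, a₁⟩

theorem iteFalse {x : ℕ} (hx : x < k) (h : S x = .nil) (hq : Trans k q S t R) :
    Trans k (.ite x p q) S (1 + t) R := by
  intro S₀ h₀
  obtain ⟨S₁, h₁, a₁⟩ := hq S₀ h₀
  exact ⟨S₁, .iteFalse (by rwa [h₀ x hx]) h₁, a₁⟩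

theorem loopDone {x : ℕ} (hx : x < k) (h : S x = .nil) : Trans k (.loop x p) S 1 S :=
  fun S₀ h₀ => ⟨S₀, .loopDone (by rwa [h₀ x hx]), h₀⟩

theorem loopStep {x : ℕ} (hx : x < k) (h : S x ≠ .nil) (hp : Trans k p S t R)
    (hq : Trans k (.loop x p) R u Q) : Trans k (.loop x p) S (1 + t + u) Q := by
  intro S₀ h₀
  obtain ⟨S₁, h₁, a₁⟩ := hp S₀ h₀
  obtain ⟨S₂, h₂, a₂⟩ := hq S₁ a₁
  exact ⟨S₂, .loopStep (by rwa [h₀ x hx]) h₁ h₂, a₂⟩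

/-- The callee expects all registers but its input to be `nil`, and a loop may have left garbage
there. Hence each call first clears the work space, at a cost depending only on `p`. -/
theorem call {x y : ℕ} {e : Dat} (hx : x < k) (h : p.Outputs (S x) t e) :
    Trans k (p.call x y k) S (t + p.bound + 3) (Function.update S y e) := by
  intro S₀ h₀
  obtain ⟨s', hr, rfl⟩ := h
  obtain ⟨S₁, h₁, a₁, b₁⟩ := runs_clear (k + 1) p.bound S₀
  obtain ⟨S₂, h₂, a₂, b₂⟩ := hr.shift k (p.bound + 1) (by omega)
    (Function.update S₁ k (S₁ x)) (by
      intro r hr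
      by_cases h : r = 0
      · subst h; simp [b₁ x (by omega), h₀ x hx]
      · rw [Function.update_of_ne (by omega), a₁ _ (by omega) (by omega), if_neg h])
  refine ⟨Function.update S₂ y (S₂ k), ?_, ?_⟩
  · have := Runs.seq h₁ (.seq (.copy k x S₁) (.seq h₂ (.copy y k S₂)))
    rwa [show p.bound + 1 + (1 + (t + 1)) = t + p.bound + 3 by omega] at this
  · have h := a₂ 0 (by omega)
    rw [Nat.add_zero] at h
    rw [h]
    refine update_congr (fun r hr => ?_) _ _
    rw [b₂ r hr, Function.update_of_ne (by omega), b₁ r (by omega), h₀ r hr]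

theorem congr {R' : Store} (h : Trans k p S t R) (hR : ∀ r < k, R r = R' r) :
    Trans k p S t R' := by
  intro S₀ h₀
  obtain ⟨S₁, h₁, a₁⟩ := h S₀ h₀
  exact ⟨S₁, h₁, fun r hr => (a₁ r hr).trans (hR r hr)⟩

theorem outputs {d : Dat} (hk : 0 < k) (h : Trans k p (fun i => if i = 0 then d else .nil) t R) :
    p.Outputs d t (R 0) := by
  obtain ⟨S', h₁, a₁⟩ := h _ fun _ _ => rfl
  exact ⟨S', h₁, a₁ 0 hk⟩

end Trans

/-- First `p`, then `q`. -/
def comp (p q : Prog) : Prog := seq (p.call 0 0 1) (q.call 0 0 1)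

theorem Outputs.comp {p q : Prog} {d e f : Dat} {t u : ℕ} (hp : p.Outputs d t e)
    (hq : q.Outputs e u f) : (p.comp q).Outputs d (t + u + (p.bound + q.bound + 6)) f := by
  have h := ((Trans.call (k := 1) (x := 0) (y := 0) (S := fun i => if i = 0 then d else .nil)
    (by omega) (by simpa using hp)).seq
    (Trans.call (x := 0) (y := 0) (by omega) (by simpa using hq))).outputs (by omega)
  rw [show t + p.bound + 3 + (u + q.bound + 3) = t + u + (p.bound + q.bound + 6) by omega] at h
  simpa [Prog.comp] using h

/-- The pair of the outputs of `p` and `q`. -/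
def pair (p q : Prog) : Prog := seq (p.call 0 1 3) (seq (q.call 0 2 3) (cons 0 1 2))

theorem Outputs.pair {p q : Prog} {d e f : Dat} {t u : ℕ} (hp : p.Outputs d t e)
    (hq : q.Outputs d u f) :
    (p.pair q).Outputs d (t + u + (p.bound + q.bound + 7)) (.cons e f) := by
  have h := ((Trans.call (k := 3) (x := 0) (y := 1) (S := fun i => if i = 0 then d else .nil)
    (by omega) (by simpa using hp)).seq
    ((Trans.call (x := 0) (y := 2) (by omega) (by simpa using hq)).seq
      (Trans.cons 0 (by omega : 1 < 3) (by omega : 2 < 3) _))).outputs (by omega)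
  rw [show t + p.bound + 3 + (u + q.bound + 3 + 1) = t + u + (p.bound + q.bound + 7) by omega] at h
  simpa [Prog.pair] using h

/-- Run `q` if `p` outputs `nil`, and `r` otherwise. -/
def cond (p q r : Prog) : Prog := seq (p.call 0 1 2) (ite 1 (r.call 0 0 2) (q.call 0 0 2))

theorem Outputs.cond_nil {p q : Prog} {d f : Dat} {t u : ℕ} (r : Prog) (hp : p.Outputs d t .nil)
    (hq : q.Outputs d u f) :
    (p.cond q r).Outputs d (t + u + (p.bound + q.bound + 7)) f := by
  have h := ((Trans.call (k := 2) (x := 0) (y := 1) (S := fun i => if i = 0 then d else .nil)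
    (by omega) (by simpa using hp)).seq
    (Trans.iteFalse (x := 1) (p := r.call 0 0 2) (by omega) (by simp)
      (Trans.call (x := 0) (y := 0) (by omega) (by simpa using hq)))).outputs (by omega)
  rw [show t + p.bound + 3 + (1 + (u + q.bound + 3)) = t + u + (p.bound + q.bound + 7) by omega] at h
  simpa [Prog.cond] using h

theorem Outputs.cond_ne_nil {p r : Prog} {d e f : Dat} {t u : ℕ} (q : Prog)
    (hp : p.Outputs d t e) (he : e ≠ .nil) (hr : r.Outputs d u f) :
    (p.cond q r).Outputs d (t + u + (p.bound + r.bound + 7)) f := by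
  have h := ((Trans.call (k := 2) (x := 0) (y := 1) (S := fun i => if i = 0 then d else .nil)
    (by omega) (by simpa using hp)).seq
    (Trans.iteTrue (x := 1) (q := q.call 0 0 2) (by omega) (by simpa using he)
      (Trans.call (x := 0) (y := 0) (by omega) (by simpa using hr)))).outputs (by omega)
  rw [show t + p.bound + 3 + (1 + (u + r.bound + 3)) = t + u + (p.bound + r.bound + 7) by omega] at h
  simpa [Prog.cond] using h

/-- The body of the loop in `Prog.fold`. -/
def foldBody (p : Prog) : Prog :=
  seq (hd 3 2) (seq (tl 2 2) (seq (cons 3 1 3) (seq (cons 3 0 3) (p.call 3 1 4))))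

/-- Fold `p` over the list that `q` outputs, starting with the state that `r` outputs. -/
def fold (p q r : Prog) : Prog :=
  seq (r.call 0 1 4) (seq (q.call 0 2 4) (seq (loop 2 p.foldBody) (copy 0 1)))

/-- The store of `Prog.fold`, with the input, the state, the rest of the list, and scratch space. -/
def foldStore (d s l x : Dat) : Store
  | 0 => d
  | 1 => s
  | 2 => l
  | 3 => x
  | _ => .nil

/-- The body is assumed correct, within `u` steps, only on states reached after a prefix of the
list: a uniform time bound is available only there. The tree `y` is what remains in the scratch
register. -/
theorem Trans.foldLoop {σ γ : Type*} (p : Prog) (d : Dat) (eσ : σ → Dat) (eγ : γ → Dat)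
    (step : σ → γ → σ) (u : ℕ) (l : List γ) (s : σ)
    (h : ∀ l₁ c l₂, l = l₁ ++ c :: l₂ → ∃ t ≤ u, p.Outputs
      (.cons d (.cons (eσ (l₁.foldl step s)) (eγ c))) t (eσ ((l₁ ++ [c]).foldl step s))) (x : Dat) :
    ∃ t ≤ l.length * (u + p.bound + 8) + 1, ∃ y : Dat,
      Trans 4 (.loop 2 p.foldBody) (foldStore d (eσ s) (.ofList (l.map eγ)) x) t
        (foldStore d (eσ (l.foldl step s)) .nil y) := by
  induction l generalizing s x with
  | nil => exact ⟨1, by omega, x, Trans.loopDone (by omega) rfl⟩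
  | cons c l ih =>
    obtain ⟨t₁, ht₁, h₁⟩ := h [] c l rfl
    obtain ⟨t₂, ht₂, y, h₂⟩ := ih (step s c)
      (fun l₁ c' l₂ hl => h (c :: l₁) c' l₂ (by simp [hl]))
      (.cons d (.cons (eσ s) (eγ c)))
    refine ⟨1 + (1 + (1 + (1 + (1 + (t₁ + p.bound + 3))))) + t₂, ?_, y, ?_⟩
    · rw [List.length_cons, Nat.succ_mul]; omega
    · refine Trans.loopStep (by omega) (by simp [foldStore, Dat.ofList]) ?_ h₂
      refine ((Trans.hd 3 (by omega : 2 < 4) _).seq ((Trans.tl 2 (by omega : 2 < 4) _).seq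
        ((Trans.cons 3 (by omega : 1 < 4) (by omega : 3 < 4) _).seq
        ((Trans.cons 3 (by omega : 0 < 4) (by omega : 3 < 4) _).seq
        (Trans.call (e := eσ (step s c)) (t := t₁) (x := 3) (y := 1) (by omega)
          ?_))))).congr ?_
      · simpa [foldStore, Dat.ofList, Dat.hd, Function.update] using h₁
      · intro r hr
        interval_cases r <;> simp [foldStore, Dat.ofList, Dat.hd, Dat.tl, Function.update]

theorem Outputs.fold {σ γ : Type*} {p q r : Prog} {d : Dat} {eσ : σ → Dat} {eγ : γ → Dat}
    {step : σ → γ → σ} {u tq tr : ℕ} {l : List γ} {s : σ}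
    (hq : q.Outputs d tq (.ofList (l.map eγ))) (hr : r.Outputs d tr (eσ s))
    (h : ∀ l₁ c l₂, l = l₁ ++ c :: l₂ → ∃ t ≤ u, p.Outputs
      (.cons d (.cons (eσ (l₁.foldl step s)) (eγ c))) t (eσ ((l₁ ++ [c]).foldl step s))) :
    ∃ t ≤ tq + tr + l.length * (u + (p.bound + 8)) + (q.bound + r.bound + 8),
      (p.fold q r).Outputs d t (eσ (l.foldl step s)) := by
  obtain ⟨t, ht, y, hl⟩ := Trans.foldLoop p d eσ eγ step u l s h .nil
  refine ⟨tr + r.bound + 3 + (tq + q.bound + 3 + (t + 1)), by rw [← Nat.add_assoc u]; omega, ?_⟩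
  refine (Trans.seq (R := foldStore d (eσ s) .nil .nil) (k := 4) ?_
    (Trans.seq (R := foldStore d (eσ s) (.ofList (l.map eγ)) .nil) ?_
    (hl.seq (Trans.copy 0 (by omega) _)))).outputs (by omega)
  · refine (Trans.call (x := 0) (y := 1) (by omega) (by simpa using hr)).congr ?_
    intro i hi
    interval_cases i <;> simp [foldStore, Function.update]
  · refine (Trans.call (x := 0) (y := 2) (by omega) hq).congr ?_
    intro i hi
    interval_cases i <;> simp [foldStore, Function.update]

end Prog

/-! ## Polynomial bounds -/

/-- `u` is bounded by a polynomial in `m`. -/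
def PolyBdd {α : Type*} (m u : α → ℕ) : Prop := ∃ C : ℕ, ∀ a, u a ≤ C * (m a + 1) ^ C

namespace PolyBdd

variable {α β : Type*} {m u v : α → ℕ}

/-- One constant plays the roles of coefficient and exponent; the sum of the two is large enough for
both. -/
theorem of_le_mul_pow {A B : ℕ} (h : ∀ a, u a ≤ A * (m a + 1) ^ B) : PolyBdd m u :=
  ⟨A + B, fun a => (h a).trans
    (Nat.mul_le_mul (by omega) (Nat.pow_le_pow_right (by omega) (by omega)))⟩

theorem mono (hv : PolyBdd m v) (h : ∀ a, u a ≤ v a) : PolyBdd m u :=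
  let ⟨C, hC⟩ := hv; ⟨C, fun a => (h a).trans (hC a)⟩

theorem const (m : α → ℕ) (c : ℕ) : PolyBdd m fun _ => c :=
  of_le_mul_pow (A := c) (B := 0) (by simp)

theorem self (m : α → ℕ) : PolyBdd m m := of_le_mul_pow (A := 1) (B := 1) (by simp)

theorem add (hu : PolyBdd m u) (hv : PolyBdd m v) : PolyBdd m fun a => u a + v a := by
  obtain ⟨C, hC⟩ := hu
  obtain ⟨D, hD⟩ := hv
  refine of_le_mul_pow (A := C + D) (B := C + D) fun a => ?_
  rw [Nat.add_mul]
  exact Nat.add_le_add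
    ((hC a).trans (Nat.mul_le_mul_left _ (Nat.pow_le_pow_right (by omega) (by omega))))
    ((hD a).trans (Nat.mul_le_mul_left _ (Nat.pow_le_pow_right (by omega) (by omega))))

theorem mul (hu : PolyBdd m u) (hv : PolyBdd m v) : PolyBdd m fun a => u a * v a := by
  obtain ⟨C, hC⟩ := hu
  obtain ⟨D, hD⟩ := hv
  refine of_le_mul_pow (A := C * D) (B := C + D) fun a => ?_
  refine (Nat.mul_le_mul (hC a) (hD a)).trans_eq ?_
  ring

theorem trans (hu : PolyBdd m u) (hv : PolyBdd u v) : PolyBdd m v := by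
  obtain ⟨C, hC⟩ := hu
  obtain ⟨D, hD⟩ := hv
  refine of_le_mul_pow (A := D * (C + 1) ^ D) (B := C * D) fun a => (hD a).trans ?_
  rw [Nat.mul_assoc, pow_mul, ← mul_pow]
  refine Nat.mul_le_mul_left _ (Nat.pow_le_pow_left ?_ _)
  have := hC a
  have h1 := Nat.one_le_pow C (m a + 1) (by omega)
  rw [Nat.add_mul]
  omega

theorem comp (h : PolyBdd m u) (f : β → α) : PolyBdd (fun b => m (f b)) fun b => u (f b) :=
  let ⟨C, hC⟩ := h; ⟨C, fun b => hC (f b)⟩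

end PolyBdd

/-! ## Sizes of encodings -/

namespace Dat

theorem size_ofNat (n : ℕ) : (ofNat n).size = 2 * n + 1 := by
  induction n with
  | zero => rfl
  | succ n ih => simp only [ofNat, size, ih]; omega

theorem size_ofBool_le (b : Bool) : (ofBool b).size ≤ 3 := by cases b <;> simp [ofBool, size]

theorem size_ofList_append (l l' : List Dat) :
    (ofList (l ++ l')).size + 1 = (ofList l).size + (ofList l').size := by
  induction l with
  | nil => simp [ofList, size]; omega
  | cons d l ih => simp only [List.cons_append, ofList, size]; omega

theorem size_ofList_le {l : List Dat} {s : ℕ} (h : ∀ d ∈ l, d.size ≤ s) :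
    (ofList l).size ≤ l.length * (s + 1) + 1 := by
  induction l with
  | nil => simp [ofList, size]
  | cons d l ih =>
    have h₁ := h d (by simp)
    have h₂ := ih fun e he => h e (by simp [he])
    simp only [ofList, size, List.length_cons, Nat.succ_mul]
    omega

theorem size_le_size_ofList {l : List Dat} {d : Dat} (h : d ∈ l) : d.size ≤ (ofList l).size := by
  induction l with
  | nil => simp at h
  | cons e l ih =>
    simp only [ofList, size]
    rcases List.mem_cons.1 h with rfl | h
    · omega
    · have := ih h; omega

theorem length_le_size_ofList (l : List Dat) : l.length ≤ (ofList l).size := by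
  induction l with
  | nil => simp
  | cons e l ih => simp only [ofList, size, List.length_cons]; omega

theorem size_hd_le (d : Dat) : d.hd.size ≤ d.size := by cases d <;> simp [hd, size]; omega

theorem size_tl_le (d : Dat) : d.tl.size ≤ d.size := by cases d <;> simp [tl, size]

theorem ofNat_eq_nil {n : ℕ} : ofNat n = nil ↔ n = 0 := by cases n <;> simp [ofNat]

theorem ofNat_eq_ofList (n : ℕ) :
    ofNat n = ofList ((List.replicate n ()).map fun _ => nil) := by
  induction n with
  | zero => rfl
  | succ n ih => simp [ofNat, List.replicate_succ, ofList, ih]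

theorem tl_ofNat (n : ℕ) : (ofNat n).tl = ofNat (n - 1) := by cases n <;> rfl

theorem tl_ofList (l : List Dat) : (ofList l).tl = ofList l.tail := by cases l <;> rfl

theorem ofList_eq_nil {l : List Dat} : ofList l = nil ↔ l = [] := by cases l <;> simp [ofList]

end Dat

/-! ## Polynomial time computability -/

/-- Some program computes `g a` from `e a` in time polynomial in the size of `e a`, and the size of
`g a` is also polynomial in that of `e a`. -/
def PC {α : Type*} (e g : α → Dat) : Prop :=
  ∃ (p : Prog) (T : α → ℕ), PolyBdd (fun a => (e a).size) T ∧
    (∀ a, ∃ t ≤ T a, p.Outputs (e a) t (g a)) ∧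
    PolyBdd (fun a => (e a).size) fun a => (g a).size

namespace PC

variable {α β γ σ : Type*} {e f g h : α → Dat}

theorem size (h : PC e g) : PolyBdd (fun a => (e a).size) fun a => (g a).size :=
  let ⟨_, _, _, _, h⟩ := h; h

theorem of_prog (p : Prog) (T : ℕ) (h : ∀ a, p.Outputs (e a) T (g a))
    (hs : PolyBdd (fun a => (e a).size) fun a => (g a).size) : PC e g :=
  ⟨p, fun _ => T, .const _ T, fun a => ⟨T, le_rfl, h a⟩, hs⟩

theorem of_eq (h : PC e f) (hfg : ∀ a, f a = g a) : PC e g := by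
  obtain rfl : f = g := funext hfg
  exact h

theorem refl (e : α → Dat) : PC e e :=
  of_prog (.copy 0 0) 1 (fun a => ⟨_, .copy _ _ _, by simp⟩) (.self _)

/-- The size clause of `PC` is indispensable here. Trees are shared, and `x := cons x x` doubles the
size of a tree in one step, so a polynomial running time does not bound the size of the output. -/
theorem trans (hf : PC e f) (hg : PC f g) : PC e g := by
  obtain ⟨p, T, hT, hp, hs⟩ := hf
  obtain ⟨q, U, hU, hq, hs'⟩ := hg
  refine ⟨p.comp q, _, (hT.add (hs.trans hU)).add (.const _ (p.bound + q.bound + 6)),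
    fun a => ?_, hs.trans hs'⟩
  obtain ⟨t, ht, ot⟩ := hp a
  obtain ⟨u, hu, ou⟩ := hq a
  exact ⟨_, by omega, ot.comp ou⟩

theorem comap (h : PC e g) (k : β → α) : PC (fun b => e (k b)) fun b => g (k b) :=
  let ⟨p, T, hT, hp, hs⟩ := h
  ⟨p, fun b => T (k b), hT.comp k, fun b => hp (k b), hs.comp k⟩

theorem hd (hg : PC e g) : PC e fun a => (g a).hd :=
  hg.trans (of_prog (.hd 0 0) 1 (fun a => ⟨_, .hd _ _ _, by simp⟩)
    ((PolyBdd.self _).mono fun _ => Dat.size_hd_le _))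

theorem tl (hg : PC e g) : PC e fun a => (g a).tl :=
  hg.trans (of_prog (.tl 0 0) 1 (fun a => ⟨_, .tl _ _ _, by simp⟩)
    ((PolyBdd.self _).mono fun _ => Dat.size_tl_le _))

theorem cons (hf : PC e f) (hg : PC e g) : PC e fun a => .cons (f a) (g a) := by
  obtain ⟨p, T, hT, hp, hs⟩ := hf
  obtain ⟨q, U, hU, hq, hs'⟩ := hg
  refine ⟨p.pair q, _, (hT.add hU).add (.const _ (p.bound + q.bound + 7)), fun a => ?_,
    ((PolyBdd.const _ 1).add hs).add hs'⟩
  obtain ⟨t, ht, ot⟩ := hp a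
  obtain ⟨u, hu, ou⟩ := hq a
  exact ⟨_, by omega, ot.pair ou⟩

theorem nil (e : α → Dat) : PC e fun _ => .nil :=
  of_prog (.setNil 0) 1 (fun a => ⟨_, .setNil _ _, by simp⟩) (.const _ 1)

/-- The program spells out `d`. No computability of `d` is involved, so `d` may be the value of a
classical `decide`. -/
theorem const (e : α → Dat) (d : Dat) : PC e fun _ => d := by
  induction d with
  | nil => exact nil e
  | cons a b iha ihb => exact iha.cons ihb

open Classical in
theorem ite_nil {c : α → Dat} (hc : PC e c) (hf : PC e f) (hg : PC e g) :
    PC e fun a => if c a = .nil then f a else g a := by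
  obtain ⟨p, T, hT, hp, -⟩ := hc
  obtain ⟨q, U, hU, hq, hs⟩ := hf
  obtain ⟨r, V, hV, hr, hs'⟩ := hg
  refine ⟨p.cond q r, _, ((hT.add hU).add hV).add (.const _ (p.bound + q.bound + r.bound + 7)),
    fun a => ?_, (hs.add hs').mono fun a => ?_⟩
  · obtain ⟨t, ht, ot⟩ := hp a
    obtain ⟨u, hu, ou⟩ := hq a
    obtain ⟨v, hv, ov⟩ := hr a
    by_cases h : c a = .nil
    · simp only [if_pos h]
      rw [h] at ot
      exact ⟨_, by omega, ot.cond_nil r ou⟩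
    · simp only [if_neg h]
      exact ⟨_, by omega, ot.cond_ne_nil q h ov⟩
  · by_cases h : c a = .nil
    · simp only [if_pos h]; omega
    · simp only [if_neg h]; omega

/-- A fold whose state grows by at most a polynomial in the input and the current item. -/
theorem fold {l : α → List γ} {eγ : γ → Dat} {eσ : σ → Dat} {init : α → σ} {step : α → σ → γ → σ}
    (hl : PC e fun a => .ofList ((l a).map eγ)) (hi : PC e fun a => eσ (init a))
    (hs : PC (fun x : α × σ × γ => .cons (e x.1) (.cons (eσ x.2.1) (eγ x.2.2)))
      fun x => eσ (step x.1 x.2.1 x.2.2))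
    {b : α × γ → ℕ} (hb : PolyBdd (fun x => (e x.1).size + (eγ x.2).size) b)
    (hgrow : ∀ a s c, (eσ (step a s c)).size ≤ (eσ s).size + b (a, c)) :
    PC e fun a => eσ ((l a).foldl (step a) (init a)) := by
  obtain ⟨p, T, ⟨C, hC⟩, hp, -⟩ := hs
  obtain ⟨q, U, hU, hq, hqs⟩ := hl
  obtain ⟨r, V, hV, hr, hrs⟩ := hi
  obtain ⟨B, hB⟩ := hb
  have hm : PolyBdd (fun a => (e a).size)
      fun a => (e a).size + (Dat.ofList ((l a).map eγ)).size := (PolyBdd.self _).add hqs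
  have hbB : PolyBdd (fun a => (e a).size)
      fun a => B * ((e a).size + (Dat.ofList ((l a).map eγ)).size + 1) ^ B :=
    hm.trans ⟨B, fun _ => le_rfl⟩
  have hitem : ∀ a, ∀ c ∈ l a, b (a, c) ≤
      B * ((e a).size + (Dat.ofList ((l a).map eγ)).size + 1) ^ B := by
    intro a c hc
    refine (hB _).trans (Nat.mul_le_mul_left _ (Nat.pow_le_pow_left ?_ _))
    have : (eγ c).size ≤ (Dat.ofList ((l a).map eγ)).size :=
      Dat.size_le_size_ofList (List.mem_map_of_mem hc)
    simp only
    omega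
  have hlen : ∀ a, (l a).length ≤ (Dat.ofList ((l a).map eγ)).size := fun a => by
    simpa using Dat.length_le_size_ofList ((l a).map eγ)
  -- Growth is additive and its bound does not involve the state, so all intermediate states remain
  -- polynomial in the input. With a constant factor per step they could become exponential.
  have hstate : ∀ a (l' : List γ) (s : σ), (∀ c ∈ l', c ∈ l a) →
      (eσ (l'.foldl (step a) s)).size ≤ (eσ s).size + l'.length *
        (B * ((e a).size + (Dat.ofList ((l a).map eγ)).size + 1) ^ B) := by
    intro a l'
    induction l' with
    | nil => simp
    | cons c l' ih =>
      intro s hl'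
      have h₁ := ih (step a s c) fun d hd => hl' d (by simp [hd])
      have h₂ := hgrow a s c
      have h₃ := hitem a c (hl' c (by simp))
      rw [List.foldl_cons, List.length_cons, Nat.succ_mul]
      omega
  have hS := hrs.add (hqs.mul hbB)
  have hbound : ∀ a l₁ l₂, l a = l₁ ++ l₂ → (eσ (l₁.foldl (step a) (init a))).size ≤
      (eσ (init a)).size + (Dat.ofList ((l a).map eγ)).size *
        (B * ((e a).size + (Dat.ofList ((l a).map eγ)).size + 1) ^ B) := by
    intro a l₁ l₂ h
    refine (hstate a l₁ (init a) fun c hc => by simp [h, hc]).trans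
      (Nat.add_le_add_left (Nat.mul_le_mul_right _ (le_trans ?_ (hlen a))) _)
    simp [h]
  have hmeas := ((PolyBdd.self fun a => (e a).size).add hS).add (hqs.add (.const _ 2))
  have hstep := hmeas.trans ⟨C, fun _ => le_rfl⟩
  refine ⟨p.fold q r, _, ((hU.add hV).add (hqs.mul (hstep.add (.const _ (p.bound + 8))))).add
    (.const _ (q.bound + r.bound + 8)), fun a => ?_, hS.mono fun a => ?_⟩
  · obtain ⟨t, ht, ot⟩ := hq a
    obtain ⟨u, hu, ou⟩ := hr a
    obtain ⟨w, hw, ow⟩ := Prog.Outputs.fold (p := p) (step := step a) (u := C *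
      ((e a).size + ((eσ (init a)).size + (Dat.ofList ((l a).map eγ)).size *
        (B * ((e a).size + (Dat.ofList ((l a).map eγ)).size + 1) ^ B)) +
        ((Dat.ofList ((l a).map eγ)).size + 2) + 1) ^ C) ot ou (by
      intro l₁ c l₂ hl
      obtain ⟨w, hw, ow⟩ := hp (a, l₁.foldl (step a) (init a), c)
      refine ⟨w, (hw.trans (hC _)).trans (Nat.mul_le_mul_left _ (Nat.pow_le_pow_left ?_ _)), by
        simpa using ow⟩
      have h₁ := hbound a l₁ (c :: l₂) hl
      have h₂ : (eγ c).size ≤ (Dat.ofList ((l a).map eγ)).size :=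
        Dat.size_le_size_ofList (List.mem_map_of_mem (by simp [hl]))
      simp only [Dat.size]
      omega)
    refine ⟨w, hw.trans ?_, ow⟩
    have := Nat.mul_le_mul_right (C *
      ((e a).size + ((eσ (init a)).size + (Dat.ofList ((l a).map eγ)).size *
        (B * ((e a).size + (Dat.ofList ((l a).map eγ)).size + 1) ^ B)) +
        ((Dat.ofList ((l a).map eγ)).size + 2) + 1) ^ C + (p.bound + 8)) (hlen a)
    beta_reduce
    omega
  · exact hbound a (l a) [] (by simp)

end PC

namespace PC

variable {α γ : Type*} {e f g : α → Dat}

/-! ### Lists -/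

theorem reverse {l : α → List Dat} (hl : PC e fun a => .ofList (l a)) :
    PC e fun a => .ofList (l a).reverse := by
  have h := fold (e := e) (l := l) (eγ := id) (eσ := Dat.ofList) (init := fun _ => [])
    (step := fun _ s c => c :: s) (b := fun x => x.2.size + 1) (by simpa using hl) (nil e)
    ((refl _).tl.tl.cons (refl _).tl.hd)
    (((PolyBdd.self _).add (.const _ 1)).mono fun x => by simp)
    (fun a s c => by simp only [Dat.ofList, Dat.size]; omega)
  exact h.of_eq fun a => by simp

theorem append {l l' : α → List Dat} (hl : PC e fun a => .ofList (l a))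
    (hl' : PC e fun a => .ofList (l' a)) : PC e fun a => .ofList (l a ++ l' a) := by
  have h := fold (e := e) (l := fun a => (l a).reverse) (eγ := id) (eσ := Dat.ofList) (init := l')
    (step := fun _ s c => c :: s) (b := fun x => x.2.size + 1) (by simpa using hl.reverse) hl'
    ((refl _).tl.tl.cons (refl _).tl.hd)
    (((PolyBdd.self _).add (.const _ 1)).mono fun x => by simp)
    (fun a s c => by simp only [Dat.ofList, Dat.size]; omega)
  exact h.of_eq fun a => by simp

/-- Folding from the right prepends each new piece, so the state grows by at most the size of a
piece that depends only on the input and the item, as `fold` demands. -/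
theorem flatMap {l : α → List γ} {eγ : γ → Dat} {k : α → γ → List Dat}
    (hl : PC e fun a => .ofList ((l a).map eγ))
    (hk : PC (fun x : α × γ => .cons (e x.1) (eγ x.2)) fun x => .ofList (k x.1 x.2)) :
    PC e fun a => .ofList ((l a).flatMap (k a)) := by
  have hk' : PC (fun x : α × List Dat × γ => .cons (e x.1) (.cons (.ofList x.2.1) (eγ x.2.2)))
      fun x => .ofList (k x.1 x.2.2) :=
    trans (f := fun x => .cons (e x.1) (eγ x.2.2)) ((refl _).hd.cons (refl _).tl.tl)
      (hk.comap fun x : α × List Dat × γ => (x.1, x.2.2))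
  have h := fold (e := e) (l := fun a => (l a).reverse) (eγ := eγ) (eσ := Dat.ofList)
    (init := fun _ => []) (step := fun a s c => k a c ++ s)
    (b := fun x => (Dat.ofList (k x.1 x.2)).size)
    (by simpa only [← List.map_reverse] using hl.reverse) (nil e)
    (hk'.append (l' := fun x => x.2.1) (refl _).tl.hd)
    ((((PolyBdd.self _).add (.const _ 1)).mono fun x => by simp only [Dat.size]; omega).trans
      hk.size)
    (fun a s c => by have := Dat.size_ofList_append (k a c) s; simp only; omega)
  refine h.of_eq fun a => congrArg _ ?_
  rw [List.foldl_reverse]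
  induction l a with
  | nil => rfl
  | cons c l ih => simp [ih]

/-! ### Numbers -/

theorem ite_zero {m : α → ℕ} (hm : PC e fun a => .ofNat (m a)) (hf : PC e f) (hg : PC e g) :
    PC e fun a => if m a = 0 then f a else g a := by
  refine (hm.ite_nil hf hg).of_eq fun a => ?_
  simp only [Dat.ofNat_eq_nil]

theorem ite_bool {b : α → Bool} (hb : PC e fun a => .ofBool (b a)) (hf : PC e f) (hg : PC e g) :
    PC e fun a => if b a then f a else g a := by
  refine (hb.ite_nil hg hf).of_eq fun a => ?_
  cases h : b a <;> simp [Dat.ofBool]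

theorem ite_eq {m : α → ℕ} (k : ℕ) (hm : PC e fun a => .ofNat (m a)) (hf : PC e f) (hg : PC e g) :
    PC e fun a => if m a = k then f a else g a := by
  induction k generalizing m with
  | zero => exact hm.ite_zero hf hg
  | succ k ih =>
    refine (hm.ite_zero hg (ih (m := fun a => m a - 1) ?_)).of_eq fun a => ?_
    · exact hm.tl.of_eq fun a => Dat.tl_ofNat _
    · by_cases h : m a = 0
      · rw [if_pos h, if_neg (by omega)]
      · rw [if_neg h]
        exact if_congr (by omega) rfl rfl

/-- Selection among finitely many functions. -/
theorem select {m : α → ℕ} {k : ℕ} {g : ℕ → α → Dat} (hm : PC e fun a => .ofNat (m a))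
    (hk : ∀ a, m a < k) (hg : ∀ i < k, PC e (g i)) : PC e fun a => g (m a) a := by
  have h : ∀ k' ≤ k, PC e fun a => if m a < k' then g (m a) a else .nil := by
    intro k' hk'
    induction k' with
    | zero => exact (nil e).of_eq fun a => by simp
    | succ k' ih =>
      refine (hm.ite_eq k' (hg k' (by omega)) (ih (by omega))).of_eq fun a => ?_
      by_cases h : m a = k'
      · rw [if_pos h, if_pos (by omega), h]
      · rw [if_neg h]
        exact if_congr (by omega) rfl rfl
  exact (h k le_rfl).of_eq fun a => if_pos (hk a)

theorem add_const {m : α → ℕ} (k : ℕ) (hm : PC e fun a => .ofNat (m a)) :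
    PC e fun a => .ofNat (m a + k) := by
  induction k with
  | zero => exact hm
  | succ k ih => exact (nil e).cons ih

/-- Division with remainder by a constant. -/
theorem divMod {m : α → ℕ} {q : ℕ} (c : ℕ) (hq : 0 < q) (hm : PC e fun a => .ofNat (m a)) :
    PC e fun a => .cons (.ofNat (m a % q)) (.ofNat (c * (m a / q))) := by
  -- A unary number is a list of units. The first counter runs modulo `q`, and the second gains `c`
  -- at each wrap, which yields a multiple of the quotient without a separate multiplication.
  have h := fold (e := e) (l := fun a => List.replicate (m a) ()) (eγ := fun _ => .nil)
    (eσ := fun s : ℕ × ℕ => .cons (.ofNat s.1) (.ofNat s.2)) (init := fun _ => (0, 0))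
    (step := fun _ s _ => if s.1 = q - 1 then (0, s.2 + c) else (s.1 + 1, s.2))
    (b := fun x => 2 * c + 2)
    (hm.of_eq fun a => Dat.ofNat_eq_ofList _) (const e _) ?_ (.const _ _) ?_
  · refine h.of_eq fun a => ?_
    have key : ∀ n : ℕ, (List.replicate n ()).foldl (fun (s : ℕ × ℕ) _ =>
        if s.1 = q - 1 then (0, s.2 + c) else (s.1 + 1, s.2)) (0, 0) = (n % q, c * (n / q)) := by
      intro n
      induction n with
      | zero => simp
      | succ n ih =>
        rw [List.replicate_succ', List.foldl_append, ih]
        have hr := Nat.mod_lt n hq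
        simp only [List.foldl_cons, List.foldl_nil]
        split_ifs with h
        · have h₁ : (n + 1) % q = 0 := by
            rw [Nat.add_mod, h]
            rcases Nat.lt_or_ge 1 q with h1 | h1
            · rw [Nat.mod_eq_of_lt h1, Nat.sub_add_cancel hq, Nat.mod_self]
            · obtain rfl : q = 1 := by omega
              simp
          rw [h₁, Nat.succ_div_of_dvd (Nat.dvd_of_mod_eq_zero h₁), Nat.mul_succ]
        · have h₁ : (n + 1) % q = n % q + 1 := by
            rw [Nat.add_mod, Nat.mod_eq_of_lt (a := 1) (by omega), Nat.mod_eq_of_lt (by omega)]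
          rw [h₁, Nat.succ_div_of_not_dvd (fun hd => by
            rw [Nat.mod_eq_zero_of_dvd hd] at h₁; omega)]
    rw [key]
  · refine ((refl _).tl.hd.hd.ite_eq (m := fun x => x.2.1.1) (q - 1)
      ((nil _).cons ((refl _).tl.hd.tl.add_const (m := fun x => x.2.1.2) c))
      (((nil _).cons (refl _).tl.hd.hd).cons (refl _).tl.hd.tl)).of_eq fun x => ?_
    split_ifs <;> rfl
  · intro a s x
    split_ifs <;> simp only [Dat.size, Dat.size_ofNat] <;> omega

theorem drop {m : α → ℕ} {l : α → List Dat} (hm : PC e fun a => .ofNat (m a))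
    (hl : PC e fun a => .ofList (l a)) : PC e fun a => .ofList ((l a).drop (m a)) := by
  have h := fold (e := e) (l := fun a => List.replicate (m a) ()) (eγ := fun _ => .nil)
    (eσ := Dat.ofList) (init := l) (step := fun _ s _ => s.tail) (b := fun x => 0)
    (hm.of_eq fun a => Dat.ofNat_eq_ofList _) hl
    ((refl _).tl.hd.tl.of_eq fun x => Dat.tl_ofList _) (.const _ _)
    (fun a s _ => by rw [← Dat.tl_ofList]; exact Dat.size_tl_le _)
  have key : ∀ (n : ℕ) (l : List Dat),
      (List.replicate n ()).foldl (fun (s : List Dat) _ => s.tail) l = l.drop n := by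
    intro n
    induction n with
    | zero => simp
    | succ n ih => intro l; rw [List.replicate_succ, List.foldl_cons, ih, List.drop_tail]
  exact h.of_eq fun a => congrArg _ (key _ _)

end PC

/-- The first `p` entries of a list, padded by `0`. -/
def List.firstN : ℕ → List ℕ → List ℕ
  | 0, _ => []
  | p + 1, l => l.headD 0 :: l.tail.firstN p

theorem List.firstN_eq (p : ℕ) (l : List ℕ) :
    l.firstN p = List.ofFn fun j : Fin p => l.getD j 0 := by
  induction p generalizing l with
  | zero => rfl
  | succ p ih =>
    rw [List.ofFn_succ, List.firstN, ih]
    cases l <;> simp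

/-- A table lookup, with a key of `p` numbers below `K`. -/
theorem PC.lookup {α : Type*} {e : α → Dat} {K : ℕ} (hK : 0 < K) (p : ℕ) {l : α → List ℕ}
    {g : List ℕ → α → Dat} (hl : PC e fun a => .ofList ((l a).map Dat.ofNat))
    (hlt : ∀ a, ∀ m ∈ l a, m < K) (hg : ∀ v, PC e (g v)) :
    PC e fun a => g ((l a).firstN p) a := by
  induction p generalizing l g with
  | zero => exact hg []
  | succ p ih =>
    refine PC.select (m := fun a => (l a).headD 0) (k := K)
      (g := fun i a => g (i :: (l a).tail.firstN p) a) ?_ (fun a => ?_) fun i _ => ?_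
    · refine hl.hd.of_eq fun a => ?_
      cases l a <;> rfl
    · have := hlt a
      cases h : l a with
      | nil => exact hK
      | cons m t => exact this m (by simp [h])
    · refine ih (g := fun v => g (i :: v)) (l := fun a => (l a).tail) ?_ ?_ fun v => hg _
      · exact hl.tl.of_eq fun a => by rw [Dat.tl_ofList, List.map_tail]
      · exact fun a m hm => hlt a m (List.mem_of_mem_tail hm)

/-! ## A circuit that evaluates a formula -/

/-- Rename the inputs of a gate. -/
def Gate.map {ι κ : Type} {L : ℕ} (f : ι → κ) : Gate ι L → Gate κ L
  | .const b => .const b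
  | .input u ℓ => .input (f u) ℓ
  | .not i => .not i
  | .and i j => .and i j
  | .or i j => .or i j

theorem Gate.encode_map {ι κ : Type} {L : ℕ} (f : ι → κ) (name : κ → ℕ) (g : Gate ι L) :
    (g.map f).encode name = g.encode fun u => name (f u) := by cases g <;> rfl

theorem Gate.eval_map {ι κ : Type} {L : ℕ} (f : ι → κ) (a : κ → Fin L) (w : List Bool)
    (g : Gate ι L) : (g.map f).eval a w = g.eval (fun u => a (f u)) w := by cases g <;> rfl

/-- The wires after the evaluation of further gates. -/
def evalGates {ι : Type} {L : ℕ} (a : ι → Fin L) (gs : List (Gate ι L)) (w : List Bool) :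
    List Bool := gs.foldl (fun w g => g.eval a w :: w) w

theorem evalGates_append {ι : Type} {L : ℕ} (a : ι → Fin L) (gs gs' : List (Gate ι L))
    (w : List Bool) : evalGates a (gs ++ gs') w = evalGates a gs' (evalGates a gs w) :=
  List.foldl_append

theorem evalGates_map {ι κ : Type} {L : ℕ} (f : ι → κ) (a : κ → Fin L) (gs : List (Gate ι L))
    (w : List Bool) : evalGates a (gs.map (Gate.map f)) w = evalGates (fun u => a (f u)) gs w := by
  simp only [evalGates, List.foldl_map, Gate.eval_map]

/-! ### Gate lists for terms, literals, clauses and formulas, and the wires that they produce. -/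

section Gates

variable {ι κ V W : Type} {L p q : ℕ}

/-- Gates that take the disjunction of the second to last wire with the statement that `b` holds and
the inputs `v` have the labels `c`. -/
def termGates (b : Bool) (c : Fin p → Fin L) (v : Fin p → ι) : List (Gate ι L) :=
  .const b :: ((List.finRange p).flatMap (fun j => [.input (v j) (c j), .and 0 1]) ++
    -- Let `x`, `y` be the last two wires at the start. After the constant and the `2 * p` gates of
    -- the chain, the value of the term is at position 0, `x` at `2 * p + 1` and `y` at `2 * p + 2`.
    -- The first gate updates `y`; this moves `x` to `2 * p + 2`, and the second gate copies it back
    -- to the top.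
    [.or 0 (2 * p + 2), .or (2 * p + 2) (2 * p + 2)])

/-- Gates that take the disjunction of the second to last wire with the statement that the inputs
`v` have labels that encode a bit string with `r`-th bit `s`. -/
noncomputable def litGates (enc : (Fin q → Bool) → Fin p → Fin L) (r : Fin q) (s : Bool)
    (v : Fin p → ι) : List (Gate ι L) :=
  (Finset.univ : Finset (Fin q → Bool)).toList.flatMap fun β => termGates (β r == s) (enc β) v

/-- Gates that evaluate a clause on the second to last wire, and take the conjunction with the
last. -/
noncomputable def clauseGates (enc : (Fin q → Bool) → Fin p → Fin L) (r : V → Fin q)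
    (v : V → Fin p → ι) (c : List (V × Bool)) : List (Gate ι L) :=
  -- Between clauses the top wire is the conjunction so far and the one below is `false`, an empty
  -- disjunction for the next clause. The last gate copies the new conjunction above the fresh
  -- `false`.
  c.flatMap (fun l => litGates enc (r l.1) l.2 (v l.1)) ++ [.and 0 1, .const false, .or 1 1]

/-- Gates that evaluate a formula whose variable `i` is the `r i`-th bit of the string that is
encoded by the labels of `v i`. -/
noncomputable def cnfGates (enc : (Fin q → Bool) → Fin p → Fin L) (r : V → Fin q)
    (v : V → Fin p → ι) (cs : List (List (V × Bool))) : List (Gate ι L) :=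
  [.const false, .const true] ++ cs.flatMap (clauseGates enc r v)

theorem litGates_map (f : ι → κ) (enc : (Fin q → Bool) → Fin p → Fin L) (r : Fin q) (s : Bool)
    (v : Fin p → ι) :
    (litGates enc r s v).map (Gate.map f) = litGates enc r s fun j => f (v j) := by
  simp [litGates, termGates, List.map_flatMap, Gate.map]

theorem cnfGates_map (f : ι → κ) (enc : (Fin q → Bool) → Fin p → Fin L) (r : V → Fin q)
    (v : V → Fin p → ι) (cs : List (List (V × Bool))) :
    (cnfGates enc r v cs).map (Gate.map f) = cnfGates enc r (fun i j => f (v i j)) cs := by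
  simp [cnfGates, clauseGates, List.map_flatMap, litGates_map, Gate.map]
  rfl

/-- Allows variables in `Fin φ.numVars` to be replaced by natural numbers, a type common to all
formulas, as a statement of polynomial-time computability requires. -/
theorem cnfGates_comp (f : W → V) (enc : (Fin q → Bool) → Fin p → Fin L) (r : V → Fin q)
    (v : V → Fin p → ι) (cs : List (List (W × Bool))) :
    cnfGates enc (fun i => r (f i)) (fun i => v (f i)) cs =
      cnfGates enc r v (cs.map (List.map fun l => (f l.1, l.2))) := by
  simp [cnfGates, clauseGates, List.flatMap_map]
  rfl

open Classical in
/-- The inputs `v` have labels that encode a bit string with `r`-th bit `s`. -/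
noncomputable def litHolds (enc : (Fin q → Bool) → Fin p → Fin L) (r : Fin q) (s : Bool)
    (a : Fin p → Fin L) : Bool := decide (∃ β, β r = s ∧ a = enc β)

theorem getD_append_add (u w : List Bool) (i : ℕ) :
    (u ++ w).getD (u.length + i) false = w.getD i false := by
  rw [List.getD_append_right _ _ _ _ (by omega), Nat.add_sub_cancel_left]

/-- The contents of `u` are irrelevant, but its length is needed to address the older wires beneath
it. -/
theorem evalGates_chain (a : ι → Fin L) (c : Fin p → Fin L) (v : Fin p → ι) (js : List (Fin p))
    (b : Bool) (w : List Bool) : ∃ u : List Bool, u.length = 2 * js.length ∧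
      evalGates a (js.flatMap fun j => [.input (v j) (c j), .and 0 1]) (b :: w) =
        (b && js.all fun j => decide (a (v j) = c j)) :: (u ++ w) := by
  induction js generalizing b w with
  | nil => exact ⟨[], rfl, by simp [evalGates]⟩
  | cons j js ih =>
    obtain ⟨u, hu, h⟩ := ih (decide (a (v j) = c j) && b) (decide (a (v j) = c j) :: b :: w)
    refine ⟨u ++ [decide (a (v j) = c j), b], by simp [hu]; omega, ?_⟩
    rw [List.flatMap_cons, evalGates_append]
    refine Eq.trans ?_ (h.trans ?_)
    · simp [evalGates, Gate.eval]
    · simp [Bool.and_comm b, Bool.and_assoc]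

theorem evalGates_termGates (a : ι → Fin L) (b : Bool) (c : Fin p → Fin L) (v : Fin p → ι)
    (x y : Bool) (w : List Bool) : ∃ u : List Bool,
      evalGates a (termGates b c v) (x :: y :: w) =
        x :: (y || (b && decide ((fun j => a (v j)) = c))) :: u := by
  obtain ⟨u, hu, h⟩ := evalGates_chain a c v (List.finRange p) b (x :: y :: w)
  have hall : ((List.finRange p).all fun j => decide (a (v j) = c j)) =
      decide ((fun j => a (v j)) = c) := by
    rw [Bool.eq_iff_iff]
    simp [funext_iff]
  rw [hall] at h
  rw [List.length_finRange] at hu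
  have h0 := getD_append_add u (x :: y :: w) 0
  have h1 := getD_append_add u (x :: y :: w) 1
  rw [hu, Nat.add_zero] at h0
  rw [hu] at h1
  generalize (b && decide ((fun j => a (v j)) = c)) = t at h ⊢
  refine ⟨t :: (u ++ x :: y :: w), ?_⟩
  rw [termGates, ← List.singleton_append, evalGates_append, evalGates_append]
  change evalGates a _ (evalGates a _ (b :: x :: y :: w)) = _
  rw [h]
  simp only [evalGates, List.foldl_cons, List.foldl_nil, Gate.eval, List.getD_cons_zero,
    List.getD_cons_succ, h0, h1, Bool.or_self, Bool.or_comm t]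

theorem evalGates_litGates (enc : (Fin q → Bool) → Fin p → Fin L) (r : Fin q) (s : Bool)
    (v : Fin p → ι) (a : ι → Fin L) (x y : Bool) (w : List Bool) : ∃ u : List Bool,
      evalGates a (litGates enc r s v) (x :: y :: w) =
        x :: (y || litHolds enc r s fun j => a (v j)) :: u := by
  have h : ∀ (l : List (Fin q → Bool)) (y : Bool) (w : List Bool), ∃ u : List Bool,
      evalGates a (l.flatMap fun β => termGates (β r == s) (enc β) v) (x :: y :: w) =
        x :: (y || l.any fun β => (β r == s) && decide ((fun j => a (v j)) = enc β)) :: u := by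
    intro l
    induction l with
    | nil => exact fun y w => ⟨w, by simp [evalGates]⟩
    | cons β l ih =>
      intro y w
      obtain ⟨u, hu⟩ := evalGates_termGates a (β r == s) (enc β) v x y w
      obtain ⟨u', hu'⟩ := ih _ u
      exact ⟨u', by rw [List.flatMap_cons, evalGates_append, hu, hu', List.any_cons, Bool.or_assoc]⟩
  obtain ⟨u, hu⟩ := h Finset.univ.toList y w
  refine ⟨u, hu.trans ?_⟩
  congr 3
  rw [Bool.eq_iff_iff]
  simp [litHolds]

theorem evalGates_clauseGates (enc : (Fin q → Bool) → Fin p → Fin L) (r : V → Fin q)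
    (v : V → Fin p → ι) (c : List (V × Bool)) (a : ι → Fin L) (x : Bool) (w : List Bool) :
    ∃ u : List Bool, evalGates a (clauseGates enc r v c) (x :: false :: w) =
      (x && c.any fun l => litHolds enc (r l.1) l.2 fun j => a (v l.1 j)) :: false :: u := by
  have h : ∀ (c : List (V × Bool)) (y : Bool) (w : List Bool), ∃ u : List Bool,
      evalGates a (c.flatMap fun l => litGates enc (r l.1) l.2 (v l.1)) (x :: y :: w) =
        x :: (y || c.any fun l => litHolds enc (r l.1) l.2 fun j => a (v l.1 j)) :: u := by
    intro c
    induction c with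
    | nil => exact fun y w => ⟨w, by simp [evalGates]⟩
    | cons l c ih =>
      intro y w
      obtain ⟨u, hu⟩ := evalGates_litGates enc (r l.1) l.2 (v l.1) a x y w
      obtain ⟨u', hu'⟩ := ih _ u
      exact ⟨u', by rw [List.flatMap_cons, evalGates_append, hu, hu', List.any_cons, Bool.or_assoc]⟩
  obtain ⟨u, hu⟩ := h c false w
  rw [clauseGates, evalGates_append, hu]
  exact ⟨_, by simp [evalGates, Gate.eval]; rfl⟩

/-- The second wire is recorded as well, because the reward circuit takes its sign from it. -/
theorem evalGates_cnfGates (enc : (Fin q → Bool) → Fin p → Fin L) (r : V → Fin q)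
    (v : V → Fin p → ι) (cs : List (List (V × Bool))) (a : ι → Fin L) :
    ∃ u : List Bool, evalGates a (cnfGates enc r v cs) [] =
      (cs.all fun c => c.any fun l => litHolds enc (r l.1) l.2 fun j => a (v l.1 j)) ::
        false :: u := by
  have h : ∀ (cs : List (List (V × Bool))) (x : Bool) (w : List Bool), ∃ u : List Bool,
      evalGates a (cs.flatMap (clauseGates enc r v)) (x :: false :: w) =
        (x && cs.all fun c => c.any fun l => litHolds enc (r l.1) l.2 fun j => a (v l.1 j)) ::
          false :: u := by
    intro cs
    induction cs with
    | nil => exact fun x w => ⟨w, by simp [evalGates]⟩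
    | cons c cs ih =>
      intro x w
      obtain ⟨u, hu⟩ := evalGates_clauseGates enc r v c a x w
      obtain ⟨u', hu'⟩ := ih _ u
      exact ⟨u', by
        rw [List.flatMap_cons, evalGates_append, hu, hu', List.all_cons, Bool.and_assoc]⟩
  obtain ⟨u, hu⟩ := h cs true []
  refine ⟨u, ?_⟩
  rw [cnfGates, evalGates_append]
  simpa [evalGates, Gate.eval] using hu

end Gates

/-! ## The reduction -/

/-- The clauses of a formula, with natural numbers as variables. -/
def CNF.natClauses (φ : CNF) : List (List (ℕ × Bool)) :=
  φ.clauses.map (List.map fun l => (l.1.1, l.2))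

/-- Encoding of a literal. -/
def litEncode (l : ℕ × Bool) : Dat := .cons (.ofNat l.1) (.ofBool l.2)

/-- Encoding of a clause. -/
def clauseEncode (c : List (ℕ × Bool)) : Dat := .ofList (c.map litEncode)

theorem CNF.encode_eq (φ : CNF) :
    φ.encode = .cons (.ofNat φ.numVars) (.ofList (φ.natClauses.map clauseEncode)) := by
  simp [CNF.encode, CNF.natClauses, clauseEncode, litEncode, Function.comp_def]

/-! ### The star instance of a formula and its correctness. -/

section Reduction

variable {L p q : ℕ} [NeZero q]

/-- The vertex for the `j`-th label of the block of the variable `i`. -/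
def blockVertex (p q : ℕ) {N : ℕ} (i : Fin N) (j : Fin p) : Fin (p * (N / q + 1) + 1) :=
  ⟨p * (i.1 / q) + 1 + j.1, by
    have h : i.1 / q ≤ N / q := Nat.div_le_div_right i.2.le
    have h' := Nat.mul_le_mul_left p h
    have := j.2
    rw [Nat.mul_succ]
    omega⟩

theorem mem_closedNbhd_starGraph {V : Type} (c u : V) :
    u ∈ closedNbhd (SimpleGraph.starGraph c) c := by
  by_cases h : u = c
  · exact Or.inl h
  · exact Or.inr (SimpleGraph.starGraph_center_adj (Ne.symm h))

/-- The center is rewarded for the encoding of a satisfying assignment, and the leaves are not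
rewarded. -/
noncomputable def cnfReward (enc : (Fin q → Bool) → Fin p → Fin L) (φ : CNF)
    (v : Fin (p * (φ.numVars / q + 1) + 1)) :
    Circuit (closedNbhd (SimpleGraph.starGraph (0 : Fin (p * (φ.numVars / q + 1) + 1))) v) L :=
  if h : v = 0 then
    { gates := (cnfGates enc (fun i => Fin.ofNat q i.1) (blockVertex p q) φ.clauses).map
        (Gate.map fun u => ⟨u, by rw [h]; exact mem_closedNbhd_starGraph _ u⟩)
      -- Output 1 is the wire that is constantly `false`, so the sign is positive; the numerator is
      -- the single bit on the last wire; the empty digit list makes the denominator `0 + 1`.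
      sign := 1, num := [0], den := [] }
  else { gates := [], sign := 0, num := [], den := [] }

/-- The star whose leaves carry the encoded blocks of variables. -/
noncomputable def cnfInstance (enc : (Fin q → Bool) → Fin p → Fin L) (φ : CNF) :
    NAGLInstance L where
  -- One block more than the rounded-down quotient always suffices, and vertex 0 is reserved for the
  -- center.
  n := p * (φ.numVars / q + 1) + 1
  n_pos := by omega
  graph := SimpleGraph.starGraph 0
  reward := cnfReward enc φ

/-- The labeling encodes a satisfying assignment. -/
noncomputable def cnfHolds (enc : (Fin q → Bool) → Fin p → Fin L) (φ : CNF)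
    (x : Fin (p * (φ.numVars / q + 1) + 1) → Fin L) : Bool :=
  φ.clauses.all fun c => c.any fun l =>
    litHolds enc (Fin.ofNat q l.1.1) l.2 fun j => x (blockVertex p q l.1 j)

theorem cnfReward_center (enc : (Fin q → Bool) → Fin p → Fin L) (φ : CNF)
    (x : Fin (p * (φ.numVars / q + 1) + 1) → Fin L) :
    (cnfReward enc φ 0).value (fun u => x u) = if cnfHolds enc φ x then 1 else 0 := by
  obtain ⟨u, hu⟩ := evalGates_cnfGates enc (fun i : Fin φ.numVars => Fin.ofNat q i.1)
    (blockVertex p q) φ.clauses x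
  have h : (cnfReward enc φ 0).wires (fun u => x u) = cnfHolds enc φ x :: false :: u := by
    rw [cnfReward, dif_pos rfl]
    exact (evalGates_map _ _ _ _).trans hu
  have h' : (cnfReward enc φ 0).sign = 1 ∧ (cnfReward enc φ 0).num = [0] ∧
      (cnfReward enc φ 0).den = [] := by
    rw [cnfReward, dif_pos rfl]
    exact ⟨rfl, rfl, rfl⟩
  rw [Circuit.value, h, h'.1, h'.2.1, h'.2.2]
  cases cnfHolds enc φ x <;> simp [natOfBits]

theorem cnfReward_leaf (enc : (Fin q → Bool) → Fin p → Fin L) (φ : CNF)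
    {v : Fin (p * (φ.numVars / q + 1) + 1)} (hv : v ≠ 0) (a) :
    (cnfReward enc φ v).value a = 0 := by
  rw [cnfReward, dif_neg hv]
  simp [Circuit.value, natOfBits]

theorem cnfInstance_totalReward (enc : (Fin q → Bool) → Fin p → Fin L) (φ : CNF)
    (x : Fin (p * (φ.numVars / q + 1) + 1) → Fin L) :
    (cnfInstance enc φ).totalReward x = if cnfHolds enc φ x then 1 else 0 := by
  rw [← cnfReward_center]
  exact Finset.sum_eq_single (0 : Fin (p * (φ.numVars / q + 1) + 1))
    (fun v _ hv => cnfReward_leaf enc φ hv _) (fun h => absurd (Finset.mem_univ _) h)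

theorem cnfInstance_isStar (enc : (Fin q → Bool) → Fin p → Fin L) (φ : CNF) :
    (cnfInstance enc φ).IsStar := ⟨(0 : Fin (p * (φ.numVars / q + 1) + 1)), rfl⟩

theorem cnfInstance_hasZeroOneRewards (enc : (Fin q → Bool) → Fin p → Fin L) (φ : CNF) :
    (cnfInstance enc φ).HasZeroOneRewards := by
  have key : ∀ v a, (cnfReward enc φ v).value a = 0 ∨ (cnfReward enc φ v).value a = 1 := by
    intro v a
    by_cases hv : v = 0
    · subst hv
      have h := cnfReward_center enc φ fun u => a ⟨u, mem_closedNbhd_starGraph _ u⟩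
      change (cnfReward enc φ 0).value a = _ at h
      rw [h]
      split_ifs <;> simp
    · exact Or.inl (cnfReward_leaf enc φ hv a)
  exact key

/-- By injectivity a block has at most one decoding, so all true literals agree with a single
assignment. Labels outside the range of `enc` make every literal of their block false and do no
harm. -/
theorem satisfiable_of_cnfHolds {enc : (Fin q → Bool) → Fin p → Fin L}
    (henc : Function.Injective enc) {φ : CNF} {x : Fin (p * (φ.numVars / q + 1) + 1) → Fin L}
    (h : cnfHolds enc φ x = true) : φ.Satisfiable := by
  refine ⟨fun i => Function.invFun enc (fun j => x (blockVertex p q i j)) (Fin.ofNat q i.1),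
    fun c hc => ?_⟩
  obtain ⟨l, hl, hlc⟩ := List.any_eq_true.1 (List.all_eq_true.1 h c hc)
  obtain ⟨β, hβ, hx⟩ := of_decide_eq_true hlc
  exact ⟨l, hl, by simp only [hx, Function.leftInverse_invFun henc β, hβ]⟩

theorem exists_cnfHolds (hp : 0 < p) (enc : (Fin q → Bool) → Fin p → Fin L) {φ : CNF}
    (h : φ.Satisfiable) :
    ∃ x : Fin (p * (φ.numVars / q + 1) + 1) → Fin L, cnfHolds enc φ x = true := by
  obtain ⟨σ, hσ⟩ := h
  -- Leaf `v` is entry `(v - 1) % p` of block `(v - 1) / p`, and block `B` starts at variable `q *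
  -- B`. Bits past the last variable are `false`; the label of the center is irrelevant.
  refine ⟨fun v => enc (fun b => if h : q * ((v.1 - 1) / p) + b.1 < φ.numVars then
    σ ⟨q * ((v.1 - 1) / p) + b.1, h⟩ else false) ⟨(v.1 - 1) % p, Nat.mod_lt _ hp⟩, ?_⟩
  refine List.all_eq_true.2 fun c hc => List.any_eq_true.2 ?_
  obtain ⟨l, hl, hlc⟩ := hσ c hc
  refine ⟨l, hl, decide_eq_true ⟨fun b => if h : q * (l.1.1 / q) + b.1 < φ.numVars then
    σ ⟨q * (l.1.1 / q) + b.1, h⟩ else false, ?_, ?_⟩⟩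
  · have h : q * (l.1.1 / q) + (Fin.ofNat q l.1.1).1 = l.1.1 := Nat.div_add_mod _ _
    simp only [h, Fin.is_lt, dif_pos, Fin.eta, hlc]
  · funext j
    have h : (blockVertex p q l.1 j).1 - 1 = p * (l.1.1 / q) + j.1 := by
      simp only [blockVertex]; omega
    have h₁ : (p * (l.1.1 / q) + j.1) / p = l.1.1 / q := by
      rw [Nat.mul_add_div hp, Nat.div_eq_of_lt j.2, Nat.add_zero]
    have h₂ : (p * (l.1.1 / q) + j.1) % p = j.1 := by
      rw [Nat.mul_add_mod, Nat.mod_eq_of_lt j.2]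
    simp only [h, h₁, h₂, Fin.eta]

theorem cnfHolds_iff_satisfiable {enc : (Fin q → Bool) → Fin p → Fin L} (hp : 0 < p)
    (henc : Function.Injective enc) {φ : CNF} {x : Fin (p * (φ.numVars / q + 1) + 1) → Fin L}
    (hx : (cnfInstance enc φ).IsOptimal x) : cnfHolds enc φ x = true ↔ φ.Satisfiable := by
  refine ⟨satisfiable_of_cnfHolds henc, fun h => ?_⟩
  obtain ⟨y, hy⟩ := exists_cnfHolds hp enc h
  have := hx y
  rw [cnfInstance_totalReward, cnfInstance_totalReward, if_pos hy] at this
  by_contra hne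
  rw [if_neg hne] at this
  norm_num at this

end Reduction

/-! ## The reduction in polynomial time -/

namespace PC

variable {α γ : Type*} {e f g : α → Dat}

theorem replicate {m : α → ℕ} {d : α → Dat} (hm : PC e fun a => .ofNat (m a)) (hd : PC e d) :
    PC e fun a => .ofList (List.replicate (m a) (d a)) := by
  have h := flatMap (e := e) (l := fun a => List.replicate (m a) ()) (eγ := fun _ => .nil)
    (k := fun a _ => [d a]) (hm.of_eq fun a => Dat.ofNat_eq_ofList _)
    ((trans (f := fun x => e x.1) (refl _).hd (hd.comap Prod.fst)).cons (nil _))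
  refine h.of_eq fun a => congrArg _ ?_
  induction m a with
  | zero => rfl
  | succ n ih => rw [List.replicate_succ, List.flatMap_cons, ih]; rfl

theorem any {l : α → List γ} {eγ : γ → Dat} {k : α → γ → Bool}
    (hl : PC e fun a => .ofList ((l a).map eγ))
    (hk : PC (fun x : α × γ => .cons (e x.1) (eγ x.2)) fun x => .ofBool (k x.1 x.2)) :
    PC e fun a => .ofBool ((l a).any (k a)) := by
  have h := flatMap (k := fun a c => if k a c then [.nil] else []) hl
    ((hk.ite_bool (const _ (.ofList [.nil])) (nil _)).of_eq fun x => by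
      cases k x.1 x.2 <;> rfl)
  refine (h.ite_nil (nil e) (const e (.ofBool true))).of_eq fun a => ?_
  have h' : Dat.ofList ((l a).flatMap fun c => if k a c then [Dat.nil] else []) = .nil ↔
      ((l a).any (k a)) = false := by
    simp [Dat.ofList_eq_nil]
  cases hb : (l a).any (k a)
  · rw [if_pos (h'.2 hb)]; rfl
  · rw [if_neg (fun hn => by simp [h'.1 hn] at hb)]

theorem all {l : α → List γ} {eγ : γ → Dat} {k : α → γ → Bool}
    (hl : PC e fun a => .ofList ((l a).map eγ))
    (hk : PC (fun x : α × γ => .cons (e x.1) (eγ x.2)) fun x => .ofBool (k x.1 x.2)) :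
    PC e fun a => .ofBool ((l a).all (k a)) := by
  have h := any (k := fun a c => !k a c) hl
    ((hk.ite_bool (const _ (.ofBool false)) (const _ (.ofBool true))).of_eq fun x => by
      cases k x.1 x.2 <;> rfl)
  refine (h.ite_bool (const _ (.ofBool false)) (const _ (.ofBool true))).of_eq fun a => ?_
  rw [List.all_eq_not_any_not]
  cases (l a).any fun c => !k a c <;> rfl

/-- Only the vertex names vary with the input, each by adding a constant to `m a`; logical gates
refer to relative positions and are constants. -/
theorem template {L : ℕ} {m : α → ℕ} (hm : PC e fun a => .ofNat (m a)) (T : List (Gate ℕ L)) :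
    PC e fun a => .ofList ((T.map (Gate.map (· + m a))).map (Gate.encode id)) := by
  induction T with
  | nil => exact nil e
  | cons g T ih =>
    refine cons ?_ ih
    cases g with
    | input u ℓ =>
      exact (const e (.ofNat 1)).cons ((hm.add_const u).cons (const e (.ofNat ℓ)) |>.of_eq
        fun a => by simp [Nat.add_comm])
    | const b => exact const e _
    | not i => exact const e _
    | and i j => exact const e _
    | or i j => exact const e _

section

variable {L p q : ℕ} [NeZero q]

theorem blockBase {i : α → ℕ} (p q : ℕ) [NeZero q] (hi : PC e fun a => .ofNat (i a)) :
    PC e fun a => .ofNat (p * (i a / q) + 1) :=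
  (hi.divMod p (Nat.pos_of_neZero q)).tl.add_const (m := fun a => p * (i a / q)) 1

/-- Selection by the position of a variable in its block, and by a sign. -/
theorem selectBit {i : α → ℕ} {s : α → Bool} {g : Fin q → Bool → α → Dat}
    (hi : PC e fun a => .ofNat (i a)) (hs : PC e fun a => .ofBool (s a))
    (hg : ∀ r s, PC e (g r s)) : PC e fun a => g (Fin.ofNat q (i a)) (s a) a := by
  have h := select (k := q) (m := fun a => i a % q) (g := fun r a => g (Fin.ofNat q r) (s a) a)
    (hi.divMod 0 (Nat.pos_of_neZero q)).hd (fun a => Nat.mod_lt _ (Nat.pos_of_neZero q))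
    fun r _ => (hs.ite_bool (hg (Fin.ofNat q r) true) (hg (Fin.ofNat q r) false)).of_eq
      fun a => by cases s a <;> rfl
  refine h.of_eq fun a => ?_
  have : Fin.ofNat q (i a % q) = Fin.ofNat q (i a) := Fin.ext (Nat.mod_mod _ _)
  rw [this]

/-- For a fixed position in the block and a fixed sign the gates are a constant template shifted to
the block of `i`; there are only `2 * q` such cases. -/
theorem litGates (enc : (Fin q → Bool) → Fin p → Fin L) {i : α → ℕ} {s : α → Bool}
    (hi : PC e fun a => .ofNat (i a)) (hs : PC e fun a => .ofBool (s a)) :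
    PC e fun a => .ofList ((_root_.litGates enc (Fin.ofNat q (i a)) (s a)
      fun j => j.1 + (p * (i a / q) + 1)).map (Gate.encode id)) := by
  refine selectBit (g := fun r s a => .ofList ((_root_.litGates enc r s
      fun j => j.1 + (p * (i a / q) + 1)).map (Gate.encode id))) hi hs fun r s => ?_
  refine ((hi.blockBase p q).template (_root_.litGates enc r s fun j => j.1)).of_eq fun a => ?_
  rw [litGates_map]

theorem cnfGates (enc : (Fin q → Bool) → Fin p → Fin L) {cs : α → List (List (ℕ × Bool))}
    (hcs : PC e fun a => .ofList ((cs a).map clauseEncode)) :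
    PC e fun a => .ofList ((_root_.cnfGates enc (fun i => Fin.ofNat q i)
      (fun i j => j.1 + (p * (i / q) + 1)) (cs a)).map (Gate.encode id)) := by
  simp only [_root_.cnfGates, List.map_append, List.map_flatMap, clauseGates]
  refine (const e _).append (flatMap hcs ((flatMap (l := fun x : α × List (ℕ × Bool) => x.2)
    (refl _).tl (k := fun _ l => (_root_.litGates enc (Fin.ofNat q l.1) l.2
      fun j => j.1 + (p * (l.1 / q) + 1)).map (Gate.encode id)) ?_).append (const _ _)))
  exact litGates enc (refl _).tl.hd (refl _).tl.tl

end

end PC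

/-! ### Computing the instance, and checking a labeling, in polynomial time. -/

section Reduction

variable {L p q : ℕ} [NeZero q]

theorem cnfInstance_encode (enc : (Fin q → Bool) → Fin p → Fin L) (φ : CNF) :
    (cnfInstance enc φ).encode =
      .cons (.cons (.cons .nil
          (.ofList (List.replicate (p * (φ.numVars / q) + p) (.ofBool true))))
        (.cons (.ofList ((cnfGates enc (fun i => Fin.ofNat q i)
          (fun i j => j.1 + (p * (i / q) + 1)) φ.natClauses).map (Gate.encode id)))
          (.cons (.ofNat 1) (.cons (.ofList [.nil]) .nil))))
      (.ofList (List.replicate (p * (φ.numVars / q) + p)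
        (.cons (.cons (.ofBool true)
            (.ofList (List.replicate (p * (φ.numVars / q) + p) (.ofBool false))))
          (.cons .nil (.cons .nil (.cons .nil .nil)))))) := by
  have h0 : (cnfReward enc φ 0).encode (fun u => u.1.1) =
      .cons (.ofList ((cnfGates enc (fun i => Fin.ofNat q i)
          (fun i j => j.1 + (p * (i / q) + 1)) φ.natClauses).map (Gate.encode id)))
          (.cons (.ofNat 1) (.cons (.ofList [.nil]) .nil)) := by
    rw [cnfReward, dif_pos rfl, CNF.natClauses,
      ← cnfGates_comp (fun i : Fin φ.numVars => i.1) enc (fun i => Fin.ofNat q i)]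
    have hv : (fun (i : Fin φ.numVars) (j : Fin p) => j.1 + (p * (i.1 / q) + 1)) =
        fun i j => (blockVertex p q i j).1 := by
      funext i j; simp only [blockVertex]; omega
    rw [hv, ← cnfGates_map]
    simp only [Circuit.encode, List.map_map, Function.comp_def, Gate.encode_map]
    rfl
  have hs : ∀ v : Fin (p * (φ.numVars / q + 1)), (cnfReward enc φ v.succ).encode (fun u => u.1.1) =
      .cons .nil (.cons .nil (.cons .nil .nil)) := by
    intro v
    rw [cnfReward, dif_neg (Fin.succ_ne_zero v)]
    rfl
  rw [← Nat.mul_succ]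
  change Dat.ofList (List.ofFn fun v : Fin (p * (φ.numVars / q + 1) + 1) =>
      .cons (.ofList (List.ofFn fun u : Fin (p * (φ.numVars / q + 1) + 1) =>
        .ofBool (@decide ((SimpleGraph.starGraph (0 : Fin (p * (φ.numVars / q + 1) + 1))).Adj v u)
          (Classical.propDecidable _))))
        ((cnfReward enc φ v).encode fun u => u.1.1)) = _
  rw [List.ofFn_succ, h0]
  simp only [hs, List.ofFn_succ, SimpleGraph.starGraph_adj, ne_eq, not_true_eq_false,
    decide_false, Fin.succ_ne_zero, or_false, and_true, not_false_eq_true, decide_true,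
    (Fin.succ_ne_zero _).symm, true_or, or_true, and_false, List.ofFn_const]
  rfl

theorem PC.cnfInstance (enc : (Fin q → Bool) → Fin p → Fin L) :
    PC CNF.encode fun φ => (cnfInstance enc φ).encode := by
  have hN : PC CNF.encode fun φ => .ofNat (p * (φ.numVars / q) + p) :=
    (PC.divMod (m := fun φ : CNF => φ.numVars) p (Nat.pos_of_neZero q) (refl _).hd).tl.add_const
      (m := fun φ : CNF => p * (φ.numVars / q)) p
  have hcs : PC CNF.encode fun φ => .ofList (φ.natClauses.map clauseEncode) :=
    (refl _).tl.of_eq fun φ => by rw [CNF.encode_eq]; rfl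
  exact (((((nil _).cons (hN.replicate (const _ _))).cons
    ((PC.cnfGates enc hcs).cons (const _ _))).cons
    (hN.replicate (((const _ _).cons (hN.replicate (const _ _))).cons (const _ _))))).of_eq
    fun φ => (cnfInstance_encode enc φ).symm

open Classical in
/-- The value of a literal under a list of labels. -/
noncomputable def litCheck (enc : (Fin q → Bool) → Fin p → Fin L) (x : List ℕ) (l : ℕ × Bool) :
    Bool :=
  decide (∃ β : Fin q → Bool, β (Fin.ofNat q l.1) = l.2 ∧
    (x.drop (p * (l.1 / q) + 1)).firstN p = List.ofFn fun j => (enc β j).1)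

theorem cnfHolds_eq (enc : (Fin q → Bool) → Fin p → Fin L) (φ : CNF)
    (x : Fin (p * (φ.numVars / q + 1) + 1) → Fin L) :
    cnfHolds enc φ x = φ.natClauses.all fun c => c.any fun l =>
      litCheck enc (List.ofFn fun v => (x v).1) l := by
  rw [cnfHolds, CNF.natClauses, List.all_map]
  congr 1
  funext c
  simp only [Function.comp_def, List.any_map]
  congr 1
  funext l
  rw [litHolds, litCheck, Bool.eq_iff_iff, decide_eq_true_iff, decide_eq_true_iff]
  refine exists_congr fun β => and_congr_right fun _ => ?_
  rw [List.firstN_eq, List.ofFn_inj, funext_iff, funext_iff]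
  refine forall_congr' fun j => ?_
  have h := (blockVertex p q l.1 j).2
  have h' : (List.drop (p * (l.1.1 / q) + 1) (List.ofFn fun v => (x v).1)).getD j.1 0 =
      (x (blockVertex p q l.1 j)).1 := by
    rw [List.getD_eq_getElem?_getD, List.getElem?_drop]
    change (List.ofFn fun v => (x v).1)[(blockVertex p q l.1 j).1]?.getD 0 = _
    rw [List.getElem?_ofFn, dif_pos h]
    rfl
  rw [h', Fin.ext_iff]

/-- A formula together with a list of labels. -/
def pairEncode (y : CNF × List (Fin L)) : Dat :=
  .cons y.1.encode (.ofList ((y.2.map Fin.val).map .ofNat))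

-- For each position in the block, each sign and each tuple of `p` labels the existence of a
-- suitable `β` is a constant truth value, so the test of a literal is a lookup in a finite table.
open Classical in
theorem PC.cnfCheck (hL : 0 < L) (enc : (Fin q → Bool) → Fin p → Fin L) :
    PC (pairEncode (L := L)) fun y => .ofBool (y.1.natClauses.all fun c => c.any fun l =>
      litCheck enc (y.2.map Fin.val) l) := by
  refine PC.all (eγ := clauseEncode) ((refl _).hd.tl.of_eq fun y => ?_)
    (PC.any (l := fun x : (CNF × List (Fin L)) × List (ℕ × Bool) => x.2) (eγ := litEncode)
      (refl _).tl ?_)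
  · simp only [pairEncode, CNF.encode_eq, Dat.hd, Dat.tl]
  · have hi : PC (fun x : ((CNF × List (Fin L)) × List (ℕ × Bool)) × (ℕ × Bool) =>
        .cons (.cons (pairEncode x.1.1) (clauseEncode x.1.2)) (litEncode x.2))
        fun x => .ofNat x.2.1 := (refl _).tl.hd
    have hs : PC (fun x : ((CNF × List (Fin L)) × List (ℕ × Bool)) × (ℕ × Bool) =>
        .cons (.cons (pairEncode x.1.1) (clauseEncode x.1.2)) (litEncode x.2))
        fun x => .ofBool x.2.2 := (refl _).tl.tl
    have hx : PC (fun x : ((CNF × List (Fin L)) × List (ℕ × Bool)) × (ℕ × Bool) =>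
        .cons (.cons (pairEncode x.1.1) (clauseEncode x.1.2)) (litEncode x.2))
        fun x => .ofList ((x.1.1.2.map Fin.val).map .ofNat) := (refl _).hd.hd.tl
    refine PC.selectBit (q := q) (i := fun x => x.2.1) (s := fun x => x.2.2)
      (g := fun r s
        (x : ((CNF × List (Fin L)) × List (ℕ × Bool)) × (ℕ × Bool)) => .ofBool (decide (∃ β : Fin q → Bool, β r = s ∧
        ((x.1.1.2.map Fin.val).drop (p * (x.2.1 / q) + 1)).firstN p =
          List.ofFn fun j => (enc β j).1)))
      hi hs fun r s => ?_
    refine PC.lookup hL p (l := fun x : ((CNF × List (Fin L)) × List (ℕ × Bool)) × (ℕ × Bool) =>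
        (x.1.1.2.map Fin.val).drop (p * (x.2.1 / q) + 1))
      (g := fun v _ => .ofBool (decide (∃ β : Fin q → Bool, β r = s ∧
        v = List.ofFn fun j => (enc β j).1))) ?_ ?_
      fun v => const _ _
    · exact (PC.drop (hi.blockBase p q) hx).of_eq fun x => by rw [List.map_drop]
    · intro x m hm
      obtain ⟨y, -, rfl⟩ := List.mem_map.1 (List.mem_of_mem_drop hm)
      exact y.2

end Reduction

/-! ## Treewidth -/

theorem exists_treeDecomposition_univ {V : Type} [Fintype V] (G : SimpleGraph V) :
    ∃ D : TreeDecomposition G, D.width = Fintype.card V - 1 := by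
  have hc : ∀ s : Set Unit, s.Nonempty → ((⊥ : SimpleGraph Unit).induce s).Connected := by
    intro s ⟨x, hx⟩
    have : Nonempty s := ⟨⟨x, hx⟩⟩
    exact SimpleGraph.Connected.mk fun a b => by rw [Subsingleton.elim a b]
  refine ⟨{ I := Unit
            tree := ⊥
            isTree := ⟨SimpleGraph.Connected.mk fun a b => by rw [Subsingleton.elim a b],
              SimpleGraph.isAcyclic_bot⟩
            bag := fun _ => Finset.univ
            vertex_mem := fun _ => ⟨(), Finset.mem_univ _⟩
            edge_mem := fun _ _ _ => ⟨(), Finset.mem_univ _, Finset.mem_univ _⟩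
            connected := fun v => hc _ ⟨(), Finset.mem_univ _⟩ }, ?_⟩
  simp [TreeDecomposition.width]

theorem treewidth_le {V : Type} [Fintype V] (G : SimpleGraph V) :
    treewidth G ≤ Fintype.card V - 1 := Nat.sInf_le (exists_treeDecomposition_univ G)

/-- Needed only when `L - ε ≤ 0`; the reduction itself uses just the upper bound on treewidth. -/
theorem one_le_treewidth {V : Type} [Fintype V] {G : SimpleGraph V} {u v : V} (h : G.Adj u v) :
    1 ≤ treewidth G := by
  obtain ⟨D, hD⟩ := Nat.sInf_mem (s := {w | ∃ D : TreeDecomposition G, D.width = w})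
    ⟨_, exists_treeDecomposition_univ G⟩
  rw [treewidth, ← hD]
  obtain ⟨i, hu, hv⟩ := D.edge_mem u v h
  let := D.fintypeI
  have h₁ : 1 < (D.bag i).card := Finset.one_lt_card.2 ⟨u, hu, v, hv, h.ne⟩
  have h₂ : (D.bag i).card ≤ Finset.univ.sup fun i => (D.bag i).card :=
    Finset.le_sup (f := fun i => (D.bag i).card) (Finset.mem_univ i)
  rw [TreeDecomposition.width]
  omega

/-! ## The size of `k`-CNF formulas -/

/-- A clause of length at most `k` is determined by its `k` optional entries, each with `2 * N + 1`
possible values, and clauses are not repeated. -/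
theorem CNF.length_clauses_le {φ : CNF} {k : ℕ} (h : φ.IsKCNF k) :
    φ.clauses.length ≤ (2 * φ.numVars + 1) ^ k := by
  have hn : (φ.clauses.map fun c (j : Fin k) => getElem? c j.1).Nodup := by
    refine List.Nodup.map_on (fun c hc d hd hcd => ?_) φ.nodup
    refine List.ext_getElem? fun j => ?_
    by_cases hj : j < k
    · exact congrFun hcd ⟨j, hj⟩
    · rw [List.getElem?_eq_none ((h c hc).trans (by omega)),
        List.getElem?_eq_none ((h d hd).trans (by omega))]
  have := hn.length_le_card
  simpa [Nat.mul_comm] using this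

theorem CNF.size_encode_le {φ : CNF} {k : ℕ} (h : φ.IsKCNF k) :
    φ.encode.size ≤ 2 * φ.numVars + 3 +
      (2 * φ.numVars + 1) ^ k * (k * (2 * φ.numVars + 6) + 2) := by
  have hcl : ∀ d ∈ φ.clauses.map (fun c => Dat.ofList (c.map fun l =>
      .cons (.ofNat l.1) (.ofBool l.2))), d.size ≤ k * (2 * φ.numVars + 6) + 1 := by
    intro d hd
    obtain ⟨c, hc, rfl⟩ := List.mem_map.1 hd
    refine (Dat.size_ofList_le (s := 2 * φ.numVars + 5) ?_).trans ?_
    · intro d hd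
      obtain ⟨l, -, rfl⟩ := List.mem_map.1 hd
      have := Dat.size_ofBool_le l.2
      have := l.1.2
      simp only [Dat.size, Dat.size_ofNat]
      omega
    · rw [List.length_map]
      exact Nat.add_le_add_right (Nat.mul_le_mul_right _ (h c hc)) _
  have h₁ := Dat.size_ofList_le hcl
  rw [List.length_map] at h₁
  change _ ≤ _ * (k * (2 * φ.numVars + 6) + 2) + 1 at h₁
  have h₂ := Nat.mul_le_mul_right (k * (2 * φ.numVars + 6) + 2) (CNF.length_clauses_le h)
  simp only [CNF.encode, Dat.size, Dat.size_ofNat]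
  omega

theorem CNF.polyBdd_size_encode (k : ℕ) :
    PolyBdd (fun φ : {φ : CNF // φ.IsKCNF k} => φ.1.numVars) fun φ => φ.1.encode.size := by
  have h2 : PolyBdd (fun φ : {φ : CNF // φ.IsKCNF k} => φ.1.numVars)
      fun φ => 2 * φ.1.numVars := (PolyBdd.const _ 2).mul (.self _)
  have hp : PolyBdd (fun φ : {φ : CNF // φ.IsKCNF k} => φ.1.numVars)
      fun φ => (2 * φ.1.numVars + 1) ^ k :=
    h2.trans (PolyBdd.of_le_mul_pow (A := 1) (B := k) fun _ => by simp)
  exact ((h2.add (.const _ 3)).add (hp.mul (((PolyBdd.const _ k).mul (h2.add (.const _ 6))).add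
    (.const _ 2)))).mono fun φ => CNF.size_encode_le φ.2

/-! ## The lower bound -/

theorem NAGLSolvable.mono {L : ℕ} {P P' : NAGLInstance L → Prop} {T T' : NAGLInstance L → ℝ}
    (h : NAGLSolvable P T) (hP : ∀ I, P' I → P I) (hT : ∀ I, P' I → T I ≤ T' I) :
    NAGLSolvable P' T' := by
  obtain ⟨p, hp⟩ := h
  refine ⟨p, fun I hI => ?_⟩
  obtain ⟨t, x, hx, ho, ht⟩ := hp I (hP I hI)
  exact ⟨t, x, hx, ho, ht.trans (hT I hI)⟩

theorem Dat.size_encodeLabeling_le {L n : ℕ} (x : Fin n → Fin L) :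
    (NAGLInstance.encodeLabeling x).size ≤ n * (2 * L + 2) + 1 := by
  refine (Dat.size_ofList_le (s := 2 * L + 1) fun d hd => ?_).trans (by simp)
  obtain ⟨v, rfl⟩ := (List.mem_ofFn' _ _).1 hd
  have := (x v).2
  rw [Dat.size_ofNat]
  omega

/-! ### From an algorithm for NAGL to one for `k`-SAT. -/

section Reduction

variable {L p q : ℕ} [NeZero q]

theorem cnfInstance_twSq_le (enc : (Fin q → Bool) → Fin p → Fin L) (φ : CNF) :
    (cnfInstance enc φ).twSq ≤ p * (φ.numVars / q + 1) := by
  refine (treewidth_le _).trans_eq ?_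
  rw [Fintype.card_fin]
  rfl

theorem polyBdd_cnfInstance_size (enc : (Fin q → Bool) → Fin p → Fin L) (k : ℕ) :
    PolyBdd (fun φ : {φ : CNF // φ.IsKCNF k} => φ.1.numVars)
      fun φ => (cnfInstance enc φ.1).size :=
  (CNF.polyBdd_size_encode k).trans ((PC.cnfInstance enc).size.comp Subtype.val)

/-- The size is polynomial in `N`, and `N + 1 ≤ q * n` with `q` fixed, so it is polynomial in `n`.
-/
theorem cnfInstance_size_le (hp : 0 < p) (enc : (Fin q → Bool) → Fin p → Fin L) (k : ℕ) :
    ∃ c : ℕ, ∀ φ : CNF, φ.IsKCNF k →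
      (cnfInstance enc φ).size ≤ c * (cnfInstance enc φ).n ^ c := by
  obtain ⟨D, hD⟩ := polyBdd_cnfInstance_size enc k
  refine ⟨D * q ^ D + D, fun φ hφ => (hD ⟨φ, hφ⟩).trans ?_⟩
  have hq : 0 < q := Nat.pos_of_neZero q
  have h₁ : φ.numVars + 1 ≤ q * (cnfInstance enc φ).n := by
    refine (Nat.lt_mul_div_succ φ.numVars hq).trans_le (Nat.mul_le_mul_left _ ?_)
    exact (Nat.le_mul_of_pos_left _ hp).trans (Nat.le_succ _)
  calc D * (φ.numVars + 1) ^ D ≤ D * (q * (cnfInstance enc φ).n) ^ D :=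
        Nat.mul_le_mul_left _ (Nat.pow_le_pow_left h₁ _)
    _ = D * q ^ D * (cnfInstance enc φ).n ^ D := by rw [mul_pow, Nat.mul_assoc]
    _ ≤ _ := Nat.mul_le_mul (by omega)
        (Nat.pow_le_pow_right (cnfInstance enc φ).n_pos (by omega))

/-- An algorithm for NAGL on the instances `cnfInstance enc φ` yields one for `k`-SAT. -/
theorem kSATSolvable_of_nAGLSolvable (hL : 0 < L) (hp : 0 < p)
    {enc : (Fin q → Bool) → Fin p → Fin L} (henc : Function.Injective enc) {k C : ℕ}
    {b b' y : ℝ} (hb : 0 ≤ b) (hbb' : b ≤ b') (hb' : 1 ≤ b') (hy : 1 ≤ y) (hby : b' ^ p ≤ y ^ q)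
    {P : NAGLInstance L → Prop} (hP : ∀ φ : CNF, φ.IsKCNF k → P (cnfInstance enc φ))
    (h : NAGLSolvable P fun I => C * b ^ I.twSq * (I.size : ℝ) ^ C) : KSATSolvable k y := by
  obtain ⟨r, hr⟩ := h
  -- The program `p₀` merely keeps the formula, which the final check needs next to the labeling.
  obtain ⟨p₀, T₀, hT₀, hp₀, -⟩ := PC.refl CNF.encode
  obtain ⟨p₁, T₁, hT₁, hp₁, -⟩ := PC.cnfInstance enc
  obtain ⟨p₂, T₂, hT₂, hp₂, -⟩ := PC.cnfCheck hL enc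
  choose tr x hx hor htr using fun φ : {φ : CNF // φ.IsKCNF k} =>
    hr (cnfInstance enc φ.1) (hP φ.1 φ.2)
  have hE := CNF.polyBdd_size_encode k
  have hn : PolyBdd (fun φ : {φ : CNF // φ.IsKCNF k} => φ.1.numVars)
      fun φ => (cnfInstance enc φ.1).n := by
    refine (((PolyBdd.const _ p).mul ((PolyBdd.self _).add (.const _ 1))).add (.const _ 1)).mono
      fun φ => ?_
    exact Nat.succ_le_succ (Nat.mul_le_mul_left _ (Nat.succ_le_succ (Nat.div_le_self _ _)))
  let z : {φ : CNF // φ.IsKCNF k} → CNF × List (Fin L) := fun φ => (φ.1, List.ofFn (x φ))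
  have hz : ∀ φ, pairEncode (z φ) =
      .cons φ.1.encode (NAGLInstance.encodeLabeling (x φ)) := by
    intro φ
    simp only [z, pairEncode, NAGLInstance.encodeLabeling, List.map_ofFn]
    rfl
  have hZ : PolyBdd (fun φ : {φ : CNF // φ.IsKCNF k} => φ.1.numVars)
      fun φ => (pairEncode (z φ)).size := by
    refine (((PolyBdd.const _ 1).add hE).add
      ((hn.mul (.const _ (2 * L + 2))).add (.const _ 1))).mono fun φ => ?_
    rw [hz]
    exact Nat.add_le_add_left (Dat.size_encodeLabeling_le _) _
  have hU : PolyBdd (fun φ : {φ : CNF // φ.IsKCNF k} => φ.1.numVars)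
      fun φ => (cnfInstance enc φ.1).size ^ C :=
    (polyBdd_cnfInstance_size enc k).trans
      (PolyBdd.of_le_mul_pow (A := 1) (B := C) fun _ => by
        rw [Nat.one_mul]; exact Nat.pow_le_pow_left (Nat.le_succ _) _)
  let K : ℕ := ((p₁.comp r).bound + p₀.bound + 7) + (p₁.bound + r.bound + 6) +
    ((p₀.pair (p₁.comp r)).bound + p₂.bound + 6)
  have hW := ((((hE.trans (hT₀.comp Subtype.val)).add (hE.trans (hT₁.comp Subtype.val))).add
    (hZ.trans (hT₂.comp z))).add (.const _ K))
  obtain ⟨D, hD⟩ := ((PolyBdd.const _ ⌈C * b' ^ p⌉₊).mul hU).add hW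
  refine ⟨(p₀.pair (p₁.comp r)).comp p₂, D, fun φ hφ => ?_⟩
  obtain ⟨t₀, ht₀, o₀⟩ := hp₀ φ
  obtain ⟨t₁, ht₁, o₁⟩ := hp₁ φ
  obtain ⟨t₂, ht₂, o₂⟩ := hp₂ (z ⟨φ, hφ⟩)
  rw [hz] at o₂
  have hall := ((o₀.pair (o₁.comp (hor ⟨φ, hφ⟩))).comp o₂)
  have hans : (φ.natClauses.all fun c => c.any fun l =>
      litCheck enc ((z ⟨φ, hφ⟩).2.map Fin.val) l) =
        @decide φ.Satisfiable (Classical.propDecidable _) := by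
    have h₁ : (z ⟨φ, hφ⟩).2.map Fin.val = List.ofFn fun v => (x ⟨φ, hφ⟩ v).1 := by
      simp only [z, List.map_ofFn]; rfl
    rw [h₁]
    refine (cnfHolds_eq enc φ (x ⟨φ, hφ⟩)).symm.trans ?_
    exact Bool.eq_iff_iff.2 ((cnfHolds_iff_satisfiable hp henc (hx ⟨φ, hφ⟩)).trans
      (@decide_eq_true_iff _ (Classical.propDecidable _)).symm)
  change Prog.Outputs _ _ _ (.ofBool (φ.natClauses.all fun c => c.any fun l =>
      litCheck enc ((z ⟨φ, hφ⟩).2.map Fin.val) l)) at hall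
  rw [hans] at hall
  refine ⟨_, hall, ?_⟩
  -- The additional block costs the constant factor `b' ^ p`. Passing to `b' ≥ 1` is necessary
  -- because the treewidth is only bounded from above.
  have hpow : b ^ (cnfInstance enc φ).twSq ≤ b' ^ p * y ^ φ.numVars := by
    calc b ^ (cnfInstance enc φ).twSq ≤ b' ^ (cnfInstance enc φ).twSq :=
          pow_le_pow_left₀ hb hbb' _
      _ ≤ b' ^ (p * (φ.numVars / q + 1)) := pow_le_pow_right₀ hb' (cnfInstance_twSq_le enc φ)
      _ = b' ^ p * (b' ^ p) ^ (φ.numVars / q) := by rw [pow_mul, pow_succ, mul_comm]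
      _ ≤ b' ^ p * (y ^ q) ^ (φ.numVars / q) := by gcongr
      _ = b' ^ p * y ^ (q * (φ.numVars / q)) := by rw [pow_mul]
      _ ≤ b' ^ p * y ^ φ.numVars := by
          gcongr; exact Nat.mul_div_le _ _
  have hy' : (1 : ℝ) ≤ y ^ φ.numVars := one_le_pow₀ hy
  have htr' : (tr ⟨φ, hφ⟩ : ℝ) ≤
      (⌈C * b' ^ p⌉₊ * (cnfInstance enc φ).size ^ C : ℕ) * y ^ φ.numVars := by
    calc (tr ⟨φ, hφ⟩ : ℝ) ≤ C * b ^ (cnfInstance enc φ).twSq * ((cnfInstance enc φ).size : ℝ) ^ C :=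
          htr ⟨φ, hφ⟩
      _ ≤ C * (b' ^ p * y ^ φ.numVars) * ((cnfInstance enc φ).size : ℝ) ^ C := by gcongr
      _ = (C * b' ^ p) * (((cnfInstance enc φ).size : ℝ) ^ C * y ^ φ.numVars) := by ring
      _ ≤ ⌈C * b' ^ p⌉₊ * (((cnfInstance enc φ).size : ℝ) ^ C * y ^ φ.numVars) := by
          gcongr; exact Nat.le_ceil _
      _ = _ := by push_cast; ring
  have hrest : t₀ + (t₁ + tr ⟨φ, hφ⟩ + (p₁.bound + r.bound + 6)) +
      (p₀.bound + (p₁.comp r).bound + 7) + t₂ +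
      ((p₀.pair (p₁.comp r)).bound + p₂.bound + 6) ≤
        tr ⟨φ, hφ⟩ + (T₀ φ + T₁ φ + T₂ (z ⟨φ, hφ⟩) + K) := by
    simp only [K]; omega
  have hD' := hD ⟨φ, hφ⟩
  beta_reduce at hD'
  calc ((_ : ℕ) : ℝ) ≤ ((tr ⟨φ, hφ⟩ + (T₀ φ + T₁ φ + T₂ (z ⟨φ, hφ⟩) + K) : ℕ) : ℝ) :=
        Nat.cast_le.2 hrest
    _ = (tr ⟨φ, hφ⟩ : ℝ) + ((T₀ φ + T₁ φ + T₂ (z ⟨φ, hφ⟩) + K : ℕ) : ℝ) * 1 := by push_cast; ring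
    _ ≤ (⌈C * b' ^ p⌉₊ * (cnfInstance enc φ).size ^ C : ℕ) * y ^ φ.numVars +
        ((T₀ φ + T₁ φ + T₂ (z ⟨φ, hφ⟩) + K : ℕ) : ℝ) * y ^ φ.numVars := by gcongr
    _ = ((⌈C * b' ^ p⌉₊ * (cnfInstance enc φ).size ^ C +
        (T₀ φ + T₁ φ + T₂ (z ⟨φ, hφ⟩) + K) : ℕ) : ℝ) * y ^ φ.numVars := by push_cast; ring
    _ ≤ ((D * (φ.numVars + 1) ^ D : ℕ) : ℝ) * y ^ φ.numVars := by
        gcongr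
    _ = D * y ^ φ.numVars * ((φ.numVars : ℝ) + 1) ^ D := by push_cast; ring

end Reduction

/-- Powers of `2` approximate powers of `L` better than powers of a smaller number do. -/
theorem exists_pow_lt_two_pow_le {L : ℕ} (hL : 2 ≤ L) {b : ℝ} (hb : 1 ≤ b) (hbL : b < L) :
    ∃ p q : ℕ, 0 < p ∧ 0 < q ∧ b ^ p < 2 ^ q ∧ 2 ^ q ≤ L ^ p := by
  have hb0 : 0 < b := by linarith
  -- With `(L / b) ^ p > 2`, rounding `L ^ p` down to a power of 2 loses less than a factor 2 and so
  -- stays above `b ^ p`.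
  obtain ⟨p, hp⟩ := pow_unbounded_of_one_lt 2 ((one_lt_div hb0).2 hbL)
  have hp0 : p ≠ 0 := by rintro rfl; norm_num at hp
  have hLp : 2 ≤ L ^ p := hL.trans (Nat.le_self_pow hp0 L)
  refine ⟨p, Nat.log 2 (L ^ p), Nat.pos_of_ne_zero hp0, Nat.log_pos (by norm_num) hLp, ?_,
    Nat.pow_log_le_self 2 (by omega)⟩
  have h₁ : (L : ℝ) ^ p < 2 ^ (Nat.log 2 (L ^ p) + 1) := by
    exact_mod_cast Nat.lt_pow_succ_log_self (b := 2) (by norm_num) (L ^ p)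
  rw [div_pow, lt_div_iff₀ (pow_pos hb0 p)] at hp
  rw [pow_succ] at h₁
  linarith

/-- A time bound that is nonpositive on the star with two vertices fails. -/
theorem exists_not_nAGLSolvable_of_nonpos {L : ℕ} (hL : 0 < L) :
    ∃ c : ℕ, ∀ (T : NAGLInstance L → ℝ), (∀ I, I.twSq = 1 → T I ≤ 0) →
      ¬ NAGLSolvable (fun I : NAGLInstance L => I.IsStar ∧ I.HasZeroOneRewards ∧
        I.size ≤ c * I.n ^ c) T := by
  -- The empty formula with `p = q = 1` gives a star on two vertices. Every run takes at least one
  -- step, which a nonpositive bound forbids.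
  let I : NAGLInstance L := cnfInstance (p := 1) (q := 1) (fun _ _ => ⟨0, by omega⟩)
    ⟨0, [], List.nodup_nil⟩
  have htw : I.twSq = 1 := by
    refine le_antisymm (cnfInstance_twSq_le _ _) ?_
    have h01 : (0 : Fin 2) ≠ 1 := by decide
    have hadj : (SimpleGraph.starGraph (0 : Fin 2)).Adj 0 1 :=
      SimpleGraph.starGraph_center_adj h01
    have h2 : (squaredGraph (SimpleGraph.starGraph (0 : Fin 2))).Adj 0 1 :=
      ⟨h01, by rw [SimpleGraph.edist_eq_one_iff_adj.2 hadj]; norm_num⟩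
    exact one_le_treewidth h2
  refine ⟨I.size, fun T hT ⟨r, hr⟩ => ?_⟩
  obtain ⟨t, x, -, ⟨s, hs, -⟩, ht⟩ := hr I ⟨cnfInstance_isStar _ _,
    cnfInstance_hasZeroOneRewards _ _, Nat.le_mul_of_pos_right _ (Nat.pow_pos I.n_pos)⟩
  have h1 : (1 : ℝ) ≤ t := by exact_mod_cast hs.one_le
  linarith [hT I htw]

theorem exists_not_nAGLSolvable {L : ℕ} (hL : 2 ≤ L) (hSETH : SETH) {b : ℝ} (hb : 0 ≤ b)
    (hbL : b < L) : ∃ c : ℕ, ∀ C : ℕ, ¬ NAGLSolvable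
      (fun I : NAGLInstance L => I.IsStar ∧ I.HasZeroOneRewards ∧ I.size ≤ c * I.n ^ c)
      (fun I => C * b ^ I.twSq * (I.size : ℝ) ^ C) := by
  have hL' : (1 : ℝ) < L := by exact_mod_cast hL
  obtain ⟨p, q, hp, hq, hbq, hqL⟩ := exists_pow_lt_two_pow_le hL (le_max_right b 1)
    (max_lt hbL hL')
  have : NeZero q := ⟨hq.ne'⟩
  obtain ⟨enc⟩ : Nonempty ((Fin q → Bool) ↪ (Fin p → Fin L)) :=
    Function.Embedding.nonempty_of_card_le (by simpa using hqL)
  have h1 : 1 ≤ max b 1 ^ p := one_le_pow₀ (le_max_right b 1)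
  -- The base that the reduction yields for `k`-SAT; SETH is applied with `δ = 2 - y`. The maximum
  -- covers `b < 1`.
  let y : ℝ := (max b 1 ^ p) ^ ((q : ℝ)⁻¹)
  have hyq : y ^ q = max b 1 ^ p := Real.rpow_inv_natCast_pow (by linarith) hq.ne'
  have hy1 : 1 ≤ y := Real.one_le_rpow h1 (by positivity)
  have hy2 : y < 2 := lt_of_pow_lt_pow_left₀ q (by norm_num) (by rw [hyq]; exact hbq)
  obtain ⟨k, -, hk⟩ := hSETH (2 - y) (by linarith)
  rw [sub_sub_cancel] at hk
  obtain ⟨c, hc⟩ := cnfInstance_size_le hp enc k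
  exact ⟨c, fun C h => hk (kSATSolvable_of_nAGLSolvable (by omega) hp enc.injective hb
    (le_max_left b 1) (le_max_right b 1) hy1 hyq.ge
    (fun φ hφ => ⟨cnfInstance_isStar _ φ, cnfInstance_hasZeroOneRewards _ φ, hc φ hφ⟩) h)⟩

/-- The first two clauses exclude running times `(L - ε) ^ tw(G²) * |I| ^ O(1)`, where `|I| ≥ n` is
the encoding size of the instance, on all instances and on stars with rewards in `{0, 1}`. The last
clause excludes `(L - ε) ^ tw(G²) * n ^ O(1)`, where `n` is the number of vertices, already when only
instances of encoding size polynomial in `n` have to be solved. -/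
theorem mainTheorem2 (L : ℕ) (hL : 2 ≤ L) (hSETH : SETH) (ε : ℝ) (hε : 0 < ε) :
    (∀ C : ℕ, ¬ NAGLSolvable (fun _ : NAGLInstance L => True)
      (fun I => C * ((L : ℝ) - ε) ^ I.twSq * (I.size : ℝ) ^ C)) ∧
    (∀ C : ℕ, ¬ NAGLSolvable (fun I : NAGLInstance L => I.IsStar ∧ I.HasZeroOneRewards)
      (fun I => C * ((L : ℝ) - ε) ^ I.twSq * (I.size : ℝ) ^ C)) ∧
    (∃ c : ℕ, ∀ C : ℕ, ¬ NAGLSolvable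
      (fun I : NAGLInstance L => I.IsStar ∧ I.HasZeroOneRewards ∧ I.size ≤ c * I.n ^ c)
      (fun I => C * ((L : ℝ) - ε) ^ I.twSq * (I.n : ℝ) ^ C)) := by
  -- For a nonpositive base the power is not monotone in the exponent and the reduction does not
  -- apply; one instance with `tw(G²) = 1` already refutes the time bound.
  rcases le_or_gt ((L : ℝ) - ε) 0 with hb | hb
  · obtain ⟨c, hc⟩ := exists_not_nAGLSolvable_of_nonpos (L := L) (by omega)
    have hT : ∀ (C : ℕ) (I : NAGLInstance L) (s : ℝ), 0 ≤ s → I.twSq = 1 →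
        C * ((L : ℝ) - ε) ^ I.twSq * s ^ C ≤ 0 := by
      intro C I s hs h
      rw [h, pow_one]
      exact mul_nonpos_of_nonpos_of_nonneg
        (mul_nonpos_of_nonneg_of_nonpos (Nat.cast_nonneg _) hb) (pow_nonneg hs _)
    refine ⟨fun C h => ?_, fun C h => ?_, c, fun C => hc _ fun I => hT C I _ (Nat.cast_nonneg _)⟩
    · exact hc _ (fun I => hT C I _ (Nat.cast_nonneg _))
        (h.mono (fun _ _ => trivial) fun _ _ => le_rfl)
    · exact hc _ (fun I => hT C I _ (Nat.cast_nonneg _))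
        (h.mono (fun _ hI => ⟨hI.1, hI.2.1⟩) fun _ _ => le_rfl)
  · obtain ⟨c, hc⟩ := exists_not_nAGLSolvable hL hSETH hb.le (sub_lt_self _ hε)
    refine ⟨fun C h => ?_, fun C h => ?_, c, fun C h => ?_⟩
    · exact hc C (h.mono (fun _ _ => trivial) fun _ _ => le_rfl)
    · exact hc C (h.mono (fun _ hI => ⟨hI.1, hI.2.1⟩) fun _ _ => le_rfl)
    · refine hc C (h.mono (fun _ hI => hI) fun I _ => ?_)
      -- As `n ≤ |I|`, a bound in terms of `n` is also one in terms of `|I|`.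
      have hn : (I.n : ℝ) ≤ I.size := by
        have := Dat.length_le_size_ofList (List.ofFn fun v : Fin I.n => Dat.cons
          (.ofList (List.ofFn fun u : Fin I.n =>
            .ofBool (@decide (I.graph.Adj v u) (Classical.propDecidable _))))
          ((I.reward v).encode fun u => u.1.1))
        rw [List.length_ofFn] at this
        exact_mod_cast this
      gcongr
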